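/- **Theorem (Convergence of gradient descent).** Let $N\ge 1$ be an integer, let $d_0,\dots,d_N$ be layer widths, $n=d_N$, $m=d_0$, and let $\Sigma_0\in\mathbb{R}^{n\times n}$ be symmetric positive semidefinite. For $W\in\mathbb{R}^{n\times m}$ let $$L^1(W)=\operatorname{tr}\Big(WW^\top+\Sigma_0-2\big(\Sigma_0^{1/2}WW^\top\Sigma_0^{1/2}\big)^{1/2}\Big)$$ be the squared Bures–Wasserstein distance between $WW^\top$ and $\Sigma_0$, and for a tuple $\overrightarrow{W}=(W_1,\dots,W_N)$ with $W_j\in\mathbb{R}^{d_j\times d_{j-1}}$ let $L^N(\overrightarrow{W})=L^1(W_N\cdots W_1)$. For a step size $\eta>0$ consider gradient descent $$\overrightarrow{W}(k+1)=\overrightarrow{W}(k)-\eta\,\nabla L^N(\overrightarrow{W}(k)),\qquad k=0,1,2,\dots,$$ and write $W(0)=W_N(0)\cdots W_1(0)$. Assume that * the initial weights are balanced: $W_j(0)W_j(0)^\top=W_{j+1}(0)^\top W_{j+1}(0)$ for $1\le j\le N-1$; * $W(0)$ has modified deficiency margin $c>0$ with respect to $\Sigma_0$: with $\Sigma=W(0)W(0)^\top$,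 $\ \min_{U\in\mathcal{O}(n)}\|\Sigma^{1/2}-\Sigma_0^{1/2}U\|_F\le\sigma_{\min}(\Sigma_0^{1/2})-c$; * the step size satisfies $$0<\eta\le\min\left\{\frac{c^2}{8M\sqrt{L^1(W(0))}},\ \frac{N c^{\frac{2(N-1)}{N}}}{2\Delta},\ \frac{1}{4Nc^{\frac{2(N-1)}{N}}}\right\},$$ where the first term is read as $+\infty$ if $L^1(W(0))=0$, and $$M=\sqrt{2\big(L^1(W(0))+\|\Sigma_0^{1/2}\|_F^2\big)},$$ $$\Delta=\frac{2^{N+1}}{c^{2N}}N^2M^{\frac{4N-3}{N}}\lambda_{\max}^{1/2}(\Sigma_0)+8N(N-1)M^{\frac{3N-4}{N}}\Big(M^{\frac1N}+\|\Sigma_0^{1/2}\|_F\Big).$$ Then $L^N$ is differentiable at every iterate $\overrightarrow{W}(k)$ (so the iteration is well defined), and for every $\epsilon>0$ one has $L^N(\overrightarrow{W}(k))\le\epsilon$ for every integer $k\ge 0$ with $$k\ge\frac{1}{2\eta N c^{\frac{2(N-1)}{N}}}\log\left(\frac{L^1(W(0))}{\epsilon}\right)$$ (if $L^1(W(0))=0$,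 for every $k\ge 0$). -/

import Mathlib

open scoped Matrix MatrixOrder

/-- The space of weight tuples `(W_1, …, W_N)` of a linear network with `N` layers and widths
`d 0, …, d N`. Layers are indexed from `0`, so the component `j` is the weight matrix `W_{j+1}`. -/
abbrev Params (N : ℕ) (d : ℕ → ℕ) : Type :=
  (j : Fin N) → Matrix (Fin (d (j + 1))) (Fin (d j)) ℝ

/-- The product `W_k ⋯ W_1` of the first `k` layers. -/
def partialProd {N : ℕ} {d : ℕ → ℕ} (W : Params N d) :
    (k : ℕ) → k ≤ N → Matrix (Fin (d k)) (Fin (d 0)) ℝ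
  | 0, _ => 1
  | k + 1, hk => W ⟨k, hk⟩ * partialProd W k (Nat.le_of_succ_le hk)

/-- The end-to-end matrix `W_N ⋯ W_1`. -/
def endToEnd {N : ℕ} {d : ℕ → ℕ} (W : Params N d) : Matrix (Fin (d N)) (Fin (d 0)) ℝ :=
  partialProd W N le_rfl

/-- Balanced weights: `W_j W_jᵀ = W_{j+1}ᵀ W_{j+1}` for any two consecutive layers. -/
def BalancedWeights {N : ℕ} {d : ℕ → ℕ} (W : Params N d) : Prop :=
  ∀ (j : ℕ) (hj : j + 1 < N),
    W ⟨j, Nat.lt_of_succ_lt hj⟩ * (W ⟨j, Nat.lt_of_succ_lt hj⟩)ᵀ =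
      (W ⟨j + 1, hj⟩)ᵀ * W ⟨j + 1, hj⟩

noncomputable section

/-- The squared Bures-Wasserstein distance
`tr (Σ + Σ₀ - 2 (Σ₀^{1/2} Σ Σ₀^{1/2})^{1/2})` of positive semidefinite matrices. -/
def buresSq {n : ℕ} (S S₀ : Matrix (Fin n) (Fin n) ℝ) : ℝ :=
  Matrix.trace (S + S₀ - (2 : ℝ) • CFC.sqrt (CFC.sqrt S₀ * S * CFC.sqrt S₀))

/-- The loss in function space, `L¹(W) = B²(W Wᵀ, Σ₀)`. -/
def lossOne {n m : ℕ} (S₀ : Matrix (Fin n) (Fin n) ℝ) (W : Matrix (Fin n) (Fin m) ℝ) : ℝ :=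
  buresSq (W * Wᵀ) S₀

/-- The loss in parameter space, `L^N(W_1, …, W_N) = L¹(W_N ⋯ W_1)`. -/
def lossN {N : ℕ} {d : ℕ → ℕ} (S₀ : Matrix (Fin (d N)) (Fin (d N)) ℝ) (W : Params N d) : ℝ :=
  lossOne S₀ (endToEnd W)

/-- The gradient of `L^N` for the scalar product `∑ⱼ tr (Aⱼᵀ Bⱼ)`: the entry `(a, b)` of its
component `j` is the derivative of `L^N` in the direction of the matrix unit `E_{ab}` in layer
`j`. (It is meaningful where `L^N` is differentiable.) -/
def gradLossN {N : ℕ} {d : ℕ → ℕ} (S₀ : Matrix (Fin (d N)) (Fin (d N)) ℝ) (W : Params N d) :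
    Params N d :=
  fun j => Matrix.of fun a b =>
    fderiv ℝ (lossN S₀ : Params N d → ℝ) W (Pi.single j (Matrix.single a b (1 : ℝ)))

/-- `W 0, W 1, …` are the iterates of gradient descent on `L^N` with step size `η`. -/
def IsGradientDescent {N : ℕ} {d : ℕ → ℕ} (S₀ : Matrix (Fin (d N)) (Fin (d N)) ℝ) (η : ℝ)
    (W : ℕ → Params N d) : Prop :=
  ∀ k, W (k + 1) = W k - η • gradLossN S₀ (W k)

/-- The Frobenius norm `(tr (Aᵀ A))^{1/2}`. -/
def frobNorm {n m : ℕ} (A : Matrix (Fin n) (Fin m) ℝ) : ℝ :=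
  Real.sqrt (Matrix.trace (Aᵀ * A))

/-- The smallest singular value of a square matrix of size `n ≥ 1`. (Mathlib lists the singular
values in decreasing order, starting from the index `0`.) -/
def sigmaMin {n : ℕ} (A : Matrix (Fin n) (Fin n) ℝ) : ℝ :=
  (Matrix.toEuclideanLin A).singularValues (n - 1)

/-- The largest eigenvalue of a symmetric matrix of size `n ≥ 1`. -/
def lambdaMax {n : ℕ} (A : Matrix (Fin n) (Fin n) ℝ) : ℝ :=
  sSup (spectrum ℝ A)

/-- `Σ` has modified deficiency margin `c` with respect to `Σ₀`:
`min_{U ∈ O(n)} ‖Σ^{1/2} - Σ₀^{1/2} U‖_F ≤ σ_min(Σ₀^{1/2}) - c`. -/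
def HasModifiedDeficiencyMargin {n : ℕ} (S₀ S : Matrix (Fin n) (Fin n) ℝ) (c : ℝ) : Prop :=
  (⨅ U : Matrix.orthogonalGroup (Fin n) ℝ,
      frobNorm (CFC.sqrt S - CFC.sqrt S₀ * (U : Matrix (Fin n) (Fin n) ℝ))) ≤
    sigmaMin (CFC.sqrt S₀) - c

/-- `M = (2 (L¹(W) + ‖Σ₀^{1/2}‖_F²))^{1/2}`. -/
def boundM {n m : ℕ} (S₀ : Matrix (Fin n) (Fin n) ℝ) (W : Matrix (Fin n) (Fin m) ℝ) : ℝ :=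
  Real.sqrt (2 * (lossOne S₀ W + frobNorm (CFC.sqrt S₀) ^ 2))

/-- `Δ = 2^{N+1} / c^{2N} · N² M^{(4N-3)/N} λ_max(Σ₀)^{1/2}
  + 8 N (N-1) M^{(3N-4)/N} (M^{1/N} + ‖Σ₀^{1/2}‖_F)`. -/
def boundDelta {n : ℕ} (N : ℕ) (c M : ℝ) (S₀ : Matrix (Fin n) (Fin n) ℝ) : ℝ :=
  2 ^ (N + 1) / c ^ (2 * N) * (N : ℝ) ^ 2 * M ^ ((4 * (N : ℝ) - 3) / N) *
      Real.sqrt (lambdaMax S₀) +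
    8 * (N : ℝ) * ((N : ℝ) - 1) * M ^ ((3 * (N : ℝ) - 4) / N) *
      (M ^ (1 / (N : ℝ)) + frobNorm (CFC.sqrt S₀))

end

/-! At `X` of full row rank the loss `L¹` is the squared Frobenius distance from `X` to a matrix `Y`
with `Y Yᵀ = Σ₀`, obtained from the polar decomposition of `Σ₀^{1/2} X`. The gradient there is `2 (X
- Y)`, and `‖X' - Y‖²` majorizes the loss at every `X'` (`exists_lossOne_eq`). A gradient step on
`L^N` is therefore a gradient step for the deep linear regression problem `‖W_N ⋯ W_1 - Y‖²`, and a
decrease of that distance is a decrease of the loss. The target `Y` may change from step to step; no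
further smoothness of the Bures distance is needed.

Balanced weights of full rank have the form `U_{j+1} b U_jᵀ` with isometric `U_j`
(`BalancedWeights.exists_isEmbedding`). Gradient descent keeps the form `U_{j+1} w_j U_jᵀ` with the
same `U_j` (`IsEmbedding.exists_gradLossN_eq`), so only square layers `w_j` have to be studied.

Suppose that all singular values of all layers lie between `κ = c^{1/N}` and `m = M^{1/N}`. Then the
squared gradient is at least `4 N κ^{2(N-1)} ‖x - y‖²`, a Polyak–Łojasiewicz inequality, and the
step size makes the higher order terms at most half of the first order decrease
(`descent_step_of_layer_bounds`). The loss contracts by the factor `1 - 2 η N κ^{2(N-1)}`. A single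
layer is computed directly.

Exact balance is lost after one step, but it changes only at order `η²` (`imbalance_step`), so the
accumulated imbalance is at most `4η` times the total decrease of the loss. With `l² = L¹(W(0))` and
`e` the current distance, the margin `l + c ≤ σ` bounds the singular values of the product below by
`σ - e ≥ c + (l - e)`. The surplus `l - e` grows as the loss falls and pays for the imbalance
(`StepsizeBound.layer_bounds`), so the constant `c` persists along the whole iteration. -/

section

open scoped Matrix.Norms.L2Operator

/-! ### Frobenius norm, operator norm and Loewner order. -/

section Frobenius

variable {n m p : ℕ}

lemma trace_transpose_mul_eq_sum (A B : Matrix (Fin n) (Fin m) ℝ) :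
    Matrix.trace (Aᵀ * B) = ∑ q : Fin m × Fin n, A q.2 q.1 * B q.2 q.1 := by
  simp [Matrix.trace, Matrix.mul_apply, Fintype.sum_prod_type]

lemma trace_transpose_mul_self_nonneg (A : Matrix (Fin n) (Fin m) ℝ) :
    0 ≤ Matrix.trace (Aᵀ * A) := by
  rw [trace_transpose_mul_eq_sum]
  exact Finset.sum_nonneg fun q _ => mul_self_nonneg _

lemma frobNorm_nonneg (A : Matrix (Fin n) (Fin m) ℝ) : 0 ≤ frobNorm A := Real.sqrt_nonneg _

lemma frobNorm_sq (A : Matrix (Fin n) (Fin m) ℝ) : frobNorm A ^ 2 = Matrix.trace (Aᵀ * A) :=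
  Real.sq_sqrt (trace_transpose_mul_self_nonneg A)

lemma frobNorm_sq_eq_trace_mul_transpose (A : Matrix (Fin n) (Fin m) ℝ) :
    frobNorm A ^ 2 = Matrix.trace (A * Aᵀ) := by
  rw [frobNorm_sq, Matrix.trace_mul_comm]

lemma trace_transpose_mul_comm (A B : Matrix (Fin n) (Fin m) ℝ) :
    Matrix.trace (Aᵀ * B) = Matrix.trace (Bᵀ * A) := by
  rw [← Matrix.trace_transpose, Matrix.transpose_mul, Matrix.transpose_transpose]

lemma frobNorm_transpose (A : Matrix (Fin n) (Fin m) ℝ) : frobNorm Aᵀ = frobNorm A := by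
  simp only [frobNorm, Matrix.transpose_transpose]
  rw [Matrix.trace_mul_comm]

lemma frobNorm_neg (A : Matrix (Fin n) (Fin m) ℝ) : frobNorm (-A) = frobNorm A := by
  simp [frobNorm]

lemma frobNorm_zero : frobNorm (0 : Matrix (Fin n) (Fin m) ℝ) = 0 := by
  simp [frobNorm]

lemma frobNorm_smul (a : ℝ) (A : Matrix (Fin n) (Fin m) ℝ) :
    frobNorm (a • A) = |a| * frobNorm A := by
  rw [frobNorm, frobNorm, ← Real.sqrt_sq_eq_abs, ← Real.sqrt_mul (sq_nonneg a)]
  congr 1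
  simp
  ring

lemma frobNorm_add_sq (A B : Matrix (Fin n) (Fin m) ℝ) :
    frobNorm (A + B) ^ 2 = frobNorm A ^ 2 + 2 * Matrix.trace (Aᵀ * B) + frobNorm B ^ 2 := by
  simp only [frobNorm_sq, Matrix.transpose_add, Matrix.add_mul, Matrix.mul_add, Matrix.trace_add]
  rw [trace_transpose_mul_comm B A]
  ring

lemma trace_transpose_mul_le (A B : Matrix (Fin n) (Fin m) ℝ) :
    Matrix.trace (Aᵀ * B) ≤ frobNorm A * frobNorm B := by
  refine le_of_sq_le_sq ?_ (mul_nonneg (frobNorm_nonneg _) (frobNorm_nonneg _))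
  rw [mul_pow, frobNorm_sq, frobNorm_sq]
  simp only [trace_transpose_mul_eq_sum]
  simpa only [sq] using Finset.sum_mul_sq_le_sq_mul_sq Finset.univ
    (fun q : Fin m × Fin n => A q.2 q.1) (fun q => B q.2 q.1)


lemma frobNorm_add_le (A B : Matrix (Fin n) (Fin m) ℝ) :
    frobNorm (A + B) ≤ frobNorm A + frobNorm B := by
  refine le_of_sq_le_sq ?_ (add_nonneg (frobNorm_nonneg _) (frobNorm_nonneg _))
  rw [frobNorm_add_sq]
  nlinarith [trace_transpose_mul_le A B]

lemma frobNorm_sub_comm (A B : Matrix (Fin n) (Fin m) ℝ) :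
    frobNorm (A - B) = frobNorm (B - A) := by
  rw [← frobNorm_neg, neg_sub]

lemma dotProduct_mulVec_self_le (A : Matrix (Fin n) (Fin m) ℝ) (v : Fin m → ℝ) :
    (A *ᵥ v) ⬝ᵥ (A *ᵥ v) ≤ ‖A‖ ^ 2 * (v ⬝ᵥ v) := by
  have h := Matrix.l2_opNorm_mulVec A (WithLp.toLp 2 v)
  have h2 := pow_le_pow_left₀ (norm_nonneg _) h 2
  rw [mul_pow, EuclideanSpace.norm_sq_eq, EuclideanSpace.norm_sq_eq] at h2
  simpa [dotProduct, sq] using h2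

lemma norm_le_of_dotProduct_mulVec_self_le {A : Matrix (Fin n) (Fin m) ℝ} {r : ℝ} (hr : 0 ≤ r)
    (h : ∀ v : Fin m → ℝ, (A *ᵥ v) ⬝ᵥ (A *ᵥ v) ≤ r ^ 2 * (v ⬝ᵥ v)) : ‖A‖ ≤ r := by
  rw [Matrix.l2_opNorm_def]
  refine ContinuousLinearMap.opNorm_le_bound _ hr fun v => ?_
  refine le_of_sq_le_sq ?_ (mul_nonneg hr (norm_nonneg _))
  rw [mul_pow, EuclideanSpace.norm_sq_eq, EuclideanSpace.norm_sq_eq]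
  simpa [dotProduct, sq, Matrix.toLpLin_apply] using h v.ofLp

lemma norm_le_frobNorm (A : Matrix (Fin n) (Fin m) ℝ) : ‖A‖ ≤ frobNorm A := by
  refine norm_le_of_dotProduct_mulVec_self_le (frobNorm_nonneg A) fun v => ?_
  rw [frobNorm_sq_eq_trace_mul_transpose]
  simp only [dotProduct, Matrix.mulVec, Matrix.trace, Matrix.diag_apply, Matrix.mul_apply,
    Matrix.transpose_apply, Finset.sum_mul (s := (Finset.univ : Finset (Fin n)))]
  refine Finset.sum_le_sum fun i _ => ?_
  simpa only [sq] using Finset.sum_mul_sq_le_sq_mul_sq Finset.univ (fun j => A i j) v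

lemma norm_transpose (A : Matrix (Fin n) (Fin m) ℝ) : ‖Aᵀ‖ = ‖A‖ := by
  rw [← Matrix.conjTranspose_eq_transpose_of_trivial, Matrix.l2_opNorm_conjTranspose]

lemma frobNorm_mul_le (A : Matrix (Fin n) (Fin m) ℝ) (B : Matrix (Fin m) (Fin p) ℝ) :
    frobNorm (A * B) ≤ ‖A‖ * frobNorm B := by
  refine le_of_sq_le_sq ?_ (mul_nonneg (norm_nonneg _) (frobNorm_nonneg _))
  rw [mul_pow, frobNorm_sq, frobNorm_sq]
  simp only [Matrix.trace, Matrix.diag_apply, Finset.mul_sum]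
  refine Finset.sum_le_sum fun j _ => ?_
  simpa [Matrix.mul_apply, dotProduct, Matrix.mulVec, mul_comm] using
    dotProduct_mulVec_self_le A (fun i => B i j)

lemma frobNorm_mul_le' (A : Matrix (Fin n) (Fin m) ℝ) (B : Matrix (Fin m) (Fin p) ℝ) :
    frobNorm (A * B) ≤ frobNorm A * ‖B‖ := by
  rw [← frobNorm_transpose, Matrix.transpose_mul, mul_comm, ← frobNorm_transpose A,
    ← norm_transpose B]
  exact frobNorm_mul_le _ _

lemma trace_le_of_le {A B : Matrix (Fin n) (Fin n) ℝ} (h : A ≤ B) :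
    Matrix.trace A ≤ Matrix.trace B := by
  have := (Matrix.le_iff.1 h).trace_nonneg
  rw [Matrix.trace_sub] at this
  linarith

lemma transpose_mul_mul_le {A B : Matrix (Fin n) (Fin n) ℝ} (h : A ≤ B)
    (Z : Matrix (Fin n) (Fin m) ℝ) : Zᵀ * A * Z ≤ Zᵀ * B * Z := by
  have := (Matrix.le_iff.1 h).conjTranspose_mul_mul_same Z
  rw [Matrix.conjTranspose_eq_transpose_of_trivial] at this
  rw [Matrix.le_iff]
  simpa [Matrix.mul_sub, Matrix.sub_mul] using this

lemma mul_frobNorm_sq_le {A : Matrix (Fin n) (Fin m) ℝ} {s : ℝ}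
    (h : s • (1 : Matrix (Fin m) (Fin m) ℝ) ≤ Aᵀ * A) (Z : Matrix (Fin m) (Fin p) ℝ) :
    s * frobNorm Z ^ 2 ≤ frobNorm (A * Z) ^ 2 := by
  have := trace_le_of_le (transpose_mul_mul_le h Z)
  rw [frobNorm_sq, frobNorm_sq]
  simpa [Matrix.mul_assoc] using this

lemma le_iff_dotProduct {A B : Matrix (Fin n) (Fin n) ℝ} (hA : Aᵀ = A) (hB : Bᵀ = B) :
    A ≤ B ↔ ∀ v : Fin n → ℝ, v ⬝ᵥ (A *ᵥ v) ≤ v ⬝ᵥ (B *ᵥ v) := by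
  rw [Matrix.le_iff, Matrix.posSemidef_iff_dotProduct_mulVec]
  constructor
  · intro h v
    have := h.2 v
    simp [Matrix.sub_mulVec] at this
    linarith
  · intro h
    refine ⟨?_, fun v => ?_⟩
    · rw [Matrix.IsHermitian, Matrix.conjTranspose_eq_transpose_of_trivial, Matrix.transpose_sub,
        hA, hB]
    · simp [Matrix.sub_mulVec]
      linarith [h v]

lemma transpose_mul_self_le_smul_one_iff {A : Matrix (Fin n) (Fin m) ℝ} {r : ℝ} (hr : 0 ≤ r) :
    Aᵀ * A ≤ r ^ 2 • (1 : Matrix (Fin m) (Fin m) ℝ) ↔ ‖A‖ ≤ r := by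
  rw [le_iff_dotProduct (by simp) (by simp)]
  have key : ∀ v : Fin m → ℝ, v ⬝ᵥ ((Aᵀ * A) *ᵥ v) = (A *ᵥ v) ⬝ᵥ (A *ᵥ v) := fun v => by
    rw [← Matrix.mulVec_mulVec, Matrix.dotProduct_mulVec, Matrix.vecMul_transpose]
  simp only [key, Matrix.smul_mulVec, Matrix.one_mulVec, dotProduct_smul, smul_eq_mul]
  refine ⟨norm_le_of_dotProduct_mulVec_self_le hr, fun h v => ?_⟩
  refine (dotProduct_mulVec_self_le A v).trans ?_
  gcongr
  simpa [dotProduct] using Finset.sum_nonneg fun i _ => mul_self_nonneg (v i)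

lemma mul_transpose_self_le_smul_one_iff {A : Matrix (Fin n) (Fin m) ℝ} {r : ℝ} (hr : 0 ≤ r) :
    A * Aᵀ ≤ r ^ 2 • (1 : Matrix (Fin n) (Fin n) ℝ) ↔ ‖A‖ ≤ r := by
  simpa [norm_transpose] using transpose_mul_self_le_smul_one_iff (A := Aᵀ) hr

lemma le_norm_smul_one {A : Matrix (Fin n) (Fin n) ℝ} (hA : Aᵀ = A) :
    A ≤ ‖A‖ • (1 : Matrix (Fin n) (Fin n) ℝ) := by
  rw [le_iff_dotProduct hA (by simp)]
  intro v
  simp only [Matrix.smul_mulVec, Matrix.one_mulVec, dotProduct_smul, smul_eq_mul]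
  have hv : 0 ≤ v ⬝ᵥ v := by
    simpa [dotProduct] using Finset.sum_nonneg fun i _ => mul_self_nonneg (v i)
  refine le_of_sq_le_sq ?_ (mul_nonneg (norm_nonneg _) hv)
  calc (v ⬝ᵥ (A *ᵥ v)) ^ 2 ≤ (v ⬝ᵥ v) * ((A *ᵥ v) ⬝ᵥ (A *ᵥ v)) := by
        simpa only [sq, dotProduct] using Finset.sum_mul_sq_le_sq_mul_sq Finset.univ v (A *ᵥ v)
    _ ≤ (v ⬝ᵥ v) * (‖A‖ ^ 2 * (v ⬝ᵥ v)) := by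
        gcongr
        exact dotProduct_mulVec_self_le A v
    _ = _ := by ring

lemma neg_norm_smul_one_le {A : Matrix (Fin n) (Fin n) ℝ} (hA : Aᵀ = A) :
    -(‖A‖ • (1 : Matrix (Fin n) (Fin n) ℝ)) ≤ A := by
  have := le_norm_smul_one (A := -A) (by simp [hA])
  rw [norm_neg] at this
  exact neg_le.1 this

lemma isSelfAdjoint_of_transpose_eq {A : Matrix (Fin n) (Fin n) ℝ} (hA : Aᵀ = A) :
    IsSelfAdjoint A := by
  rw [IsSelfAdjoint, Matrix.star_eq_conjTranspose, Matrix.conjTranspose_eq_transpose_of_trivial, hA]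

/-- Comparison with a scalar matrix is a condition on the spectrum, so the root can be taken
eigenvalue by eigenvalue. -/
lemma le_smul_one_of_pow_le {A : Matrix (Fin n) (Fin n) ℝ} (hA : Aᵀ = A) {N : ℕ} (hN : N ≠ 0)
    {b : ℝ} (hb : 0 ≤ b) (h : A ^ N ≤ b ^ N • (1 : Matrix (Fin n) (Fin n) ℝ)) :
    A ≤ b • (1 : Matrix (Fin n) (Fin n) ℝ) := by
  rw [← Algebra.algebraMap_eq_smul_one] at h ⊢
  rw [le_algebraMap_iff_spectrum_le (isSelfAdjoint_of_transpose_eq hA)]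
  rw [le_algebraMap_iff_spectrum_le (isSelfAdjoint_of_transpose_eq (by simp [hA]))] at h
  exact fun x hx => le_of_pow_le_pow_left₀ hN hb (h _ (spectrum.pow_mem_pow A N hx))

lemma smul_one_le_of_le_pow {A : Matrix (Fin n) (Fin n) ℝ} (hA : 0 ≤ A) {N : ℕ} (hN : N ≠ 0)
    {b : ℝ} (h : b ^ N • (1 : Matrix (Fin n) (Fin n) ℝ) ≤ A ^ N) :
    b • (1 : Matrix (Fin n) (Fin n) ℝ) ≤ A := by
  have hAs : IsSelfAdjoint A := .of_nonneg hA
  rw [← Algebra.algebraMap_eq_smul_one] at h ⊢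
  rw [algebraMap_le_iff_le_spectrum hAs]
  rw [algebraMap_le_iff_le_spectrum (hAs.pow N)] at h
  exact fun x hx => le_of_pow_le_pow_left₀ hN (spectrum_nonneg_of_nonneg hA hx)
    (h _ (spectrum.pow_mem_pow A N hx))

/-- `A Aᵀ` and `Aᵀ A` have the same nonzero spectrum. Since `s > 0`, the square matrix `A` is
invertible and zero does not occur. -/
lemma smul_one_le_mul_transpose {A : Matrix (Fin n) (Fin n) ℝ} {s : ℝ} (hs : 0 < s)
    (h : s • (1 : Matrix (Fin n) (Fin n) ℝ) ≤ Aᵀ * A) :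
    s • (1 : Matrix (Fin n) (Fin n) ℝ) ≤ A * Aᵀ := by
  have hpd : (Aᵀ * A).PosDef := by
    have h1 : (s • (1 : Matrix (Fin n) (Fin n) ℝ)).PosDef := Matrix.PosDef.one.smul hs
    have := h1.add_posSemidef (Matrix.le_iff.1 h)
    simpa using this
  have hu : IsUnit A := by
    rw [Matrix.isUnit_iff_isUnit_det]
    have := (Matrix.isUnit_iff_isUnit_det _).1 hpd.isUnit
    rw [Matrix.det_mul] at this
    exact isUnit_of_mul_isUnit_right this
  have hu' : IsUnit (A * Aᵀ) := hu.mul ((Matrix.isUnit_transpose A).2 hu)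
  rw [← Algebra.algebraMap_eq_smul_one] at h ⊢
  rw [algebraMap_le_iff_le_spectrum (isSelfAdjoint_of_transpose_eq (by simp))] at h ⊢
  intro x hx
  have hx0 : x ≠ 0 := fun h0 => by
    rw [h0, spectrum.zero_mem_iff] at hx
    exact hx hu'
  have hmem : x ∈ spectrum ℝ (A * Aᵀ) \ {0} := ⟨hx, hx0⟩
  rw [spectrum.nonzero_mul_comm] at hmem
  exact h x hmem.1

end Frobenius

/-! ### The Bures–Wasserstein loss as a squared distance, and its tangent quadratics. -/

section Loss

variable {n m : ℕ}

lemma transpose_eq_of_posSemidef {A : Matrix (Fin n) (Fin n) ℝ} (hA : A.PosSemidef) : Aᵀ = A := by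
  rw [← Matrix.conjTranspose_eq_transpose_of_trivial]
  exact hA.isHermitian

lemma posSemidef_sqrt (A : Matrix (Fin n) (Fin n) ℝ) : (CFC.sqrt A).PosSemidef :=
  Matrix.nonneg_iff_posSemidef.1 (CFC.sqrt_nonneg A)

lemma transpose_sqrt (A : Matrix (Fin n) (Fin n) ℝ) : (CFC.sqrt A)ᵀ = CFC.sqrt A :=
  transpose_eq_of_posSemidef (posSemidef_sqrt A)

lemma Matrix.PosSemidef.sqrt_mul_sqrt {A : Matrix (Fin n) (Fin n) ℝ} (hA : A.PosSemidef) :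
    CFC.sqrt A * CFC.sqrt A = A :=
  CFC.sqrt_mul_sqrt_self A hA.nonneg

lemma Matrix.PosDef.sqrt {A : Matrix (Fin n) (Fin n) ℝ} (hA : A.PosDef) :
    (CFC.sqrt A).PosDef := by
  rw [(posSemidef_sqrt A).posDef_iff_det_ne_zero]
  intro h0
  have h1 := hA.det_pos
  rw [← hA.posSemidef.sqrt_mul_sqrt, Matrix.det_mul, h0] at h1
  simp at h1

lemma posSemidef_mul_transpose (A : Matrix (Fin n) (Fin m) ℝ) : (A * Aᵀ).PosSemidef := by
  simpa using Matrix.posSemidef_self_mul_conjTranspose A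

lemma Matrix.PosDef.inv_mul_self {A : Matrix (Fin n) (Fin n) ℝ} (hA : A.PosDef) : A⁻¹ * A = 1 :=
  Matrix.nonsing_inv_mul _ ((Matrix.isUnit_iff_isUnit_det _).1 hA.isUnit)

lemma Matrix.PosDef.mul_inv_self {A : Matrix (Fin n) (Fin n) ℝ} (hA : A.PosDef) : A * A⁻¹ = 1 :=
  Matrix.mul_nonsing_inv _ ((Matrix.isUnit_iff_isUnit_det _).1 hA.isUnit)

/-- Young's inequality for the trace pairing, with a positive definite weight. -/
lemma two_mul_trace_mul_transpose_le (A Q : Matrix (Fin n) (Fin m) ℝ)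
    {T : Matrix (Fin n) (Fin n) ℝ} (hT : T.PosDef) :
    2 * Matrix.trace (A * Qᵀ) ≤
      Matrix.trace (T * (A * Aᵀ)) + Matrix.trace (T⁻¹ * (Q * Qᵀ)) := by
  set K := CFC.sqrt T
  have hK : K.PosDef := hT.sqrt
  have hKt : Kᵀ = K := transpose_sqrt T
  have hKK : K * K = T := hT.posSemidef.sqrt_mul_sqrt
  have hKi : K⁻¹ᵀ = K⁻¹ := by rw [Matrix.transpose_nonsing_inv, hKt]
  have hKKi : K⁻¹ * K⁻¹ = T⁻¹ := by rw [← hKK, Matrix.mul_inv_rev]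
  have h := frobNorm_add_sq (K * A) (-(K⁻¹ * Q))
  have h0 := sq_nonneg (frobNorm (K * A + -(K⁻¹ * Q)))
  rw [frobNorm_neg, frobNorm_sq (K * A), frobNorm_sq (K⁻¹ * Q)] at h
  simp only [Matrix.transpose_mul, Matrix.mul_neg, Matrix.trace_neg, hKt, hKi] at h
  have e1 : Aᵀ * K * (K * A) = Aᵀ * T * A := by rw [← hKK]; simp only [Matrix.mul_assoc]
  have e2 : Qᵀ * K⁻¹ * (K⁻¹ * Q) = Qᵀ * T⁻¹ * Q := by rw [← hKKi]; simp only [Matrix.mul_assoc]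
  have e3 : Aᵀ * K * (K⁻¹ * Q) = Aᵀ * Q := by
    rw [Matrix.mul_assoc, ← Matrix.mul_assoc K, hK.mul_inv_self, Matrix.one_mul]
  have e4 : Matrix.trace (Aᵀ * T * A) = Matrix.trace (T * (A * Aᵀ)) := by
    rw [Matrix.mul_assoc, Matrix.trace_mul_comm, Matrix.mul_assoc]
  have e5 : Matrix.trace (Qᵀ * T⁻¹ * Q) = Matrix.trace (T⁻¹ * (Q * Qᵀ)) := by
    rw [Matrix.mul_assoc, Matrix.trace_mul_comm, Matrix.mul_assoc]
  have e6 : Matrix.trace (Aᵀ * Q) = Matrix.trace (A * Qᵀ) := by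
    rw [trace_transpose_mul_comm, Matrix.trace_mul_comm]
  rw [e1, e2, e3, e4, e5, e6] at h
  linarith

/-- For positive definite `P` equality holds at `T = P^{-1/2}`. Fixing that `T` and varying `P`
gives the tangent bound of the concave function `tr P^{1/2}`, from which the lower bound on the loss
follows. -/
lemma two_mul_trace_sqrt_le {P T : Matrix (Fin n) (Fin n) ℝ} (hP : P.PosSemidef) (hT : T.PosDef) :
    2 * Matrix.trace (CFC.sqrt P) ≤ Matrix.trace (T * P) + Matrix.trace T⁻¹ := by
  have h := two_mul_trace_mul_transpose_le (CFC.sqrt P) 1 hT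
  rw [transpose_sqrt, hP.sqrt_mul_sqrt] at h
  simpa using h

lemma trace_mul_nonneg {A B : Matrix (Fin n) (Fin n) ℝ} (hA : A.PosSemidef) (hB : B.PosSemidef) :
    0 ≤ Matrix.trace (A * B) := by
  have := (hA.conjTranspose_mul_mul_same (CFC.sqrt B)).trace_nonneg
  rw [Matrix.conjTranspose_eq_transpose_of_trivial, transpose_sqrt, Matrix.mul_assoc,
    Matrix.trace_mul_comm, Matrix.mul_assoc, hB.sqrt_mul_sqrt] at this
  exact this

/-- `tr (A Qᵀ)` is at most the nuclear norm of `A` if the rows of `Q` are orthonormal. -/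
lemma trace_mul_transpose_le_trace_sqrt (A Q : Matrix (Fin n) (Fin m) ℝ) (hQ : Q * Qᵀ = 1) :
    Matrix.trace (A * Qᵀ) ≤ Matrix.trace (CFC.sqrt (A * Aᵀ)) := by
  set R := CFC.sqrt (A * Aᵀ)
  have hR : R.PosSemidef := posSemidef_sqrt _
  have hRR : R * R = A * Aᵀ := (posSemidef_mul_transpose A).sqrt_mul_sqrt
  have key : ∀ ε : ℝ, 0 < ε →
      Matrix.trace (A * Qᵀ) ≤ Matrix.trace R + ε * (n : ℝ) := fun ε hε => by
    -- The optimal weight would be `R⁻¹`, but `R` may be singular; hence the regularization by `ε`,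
    -- removed at the end.
    set T := R + ε • (1 : Matrix (Fin n) (Fin n) ℝ)
    have hT : T.PosDef := (Matrix.PosDef.one.smul hε).posSemidef_add hR
    have hTi : T⁻¹⁻¹ = T := Matrix.nonsing_inv_nonsing_inv _
      ((Matrix.isUnit_iff_isUnit_det _).1 hT.isUnit)
    have h := two_mul_trace_mul_transpose_le A Q hT.inv
    rw [hQ, hTi, ← hRR] at h
    have e : T⁻¹ * (R * R) = R - ε • (T⁻¹ * R) := by
      have : R * R = T * R - ε • R := by simp [T, Matrix.add_mul]
      rw [this, Matrix.mul_sub, ← Matrix.mul_assoc, hT.inv_mul_self]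
      simp
    have h2 : 0 ≤ Matrix.trace (T⁻¹ * R) := trace_mul_nonneg hT.inv.posSemidef hR
    rw [e, Matrix.mul_one] at h
    simp only [Matrix.trace_sub, Matrix.trace_add, Matrix.trace_smul, Matrix.trace_one, T,
      smul_eq_mul, Fintype.card_fin] at h h2
    nlinarith [Nat.cast_nonneg (α := ℝ) n, mul_nonneg hε.le h2,
      mul_nonneg hε.le (Nat.cast_nonneg (α := ℝ) n)]
  refine le_of_forall_pos_le_add fun ε hε => ?_
  refine (key (ε / (n + 1)) (by positivity)).trans ?_
  have : ε / (n + 1) * (n : ℝ) ≤ ε := by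
    rw [div_mul_eq_mul_div, div_le_iff₀ (by positivity)]
    nlinarith
  linarith

variable {S₀ : Matrix (Fin n) (Fin n) ℝ}

lemma lossOne_eq (S₀ : Matrix (Fin n) (Fin n) ℝ) (X : Matrix (Fin n) (Fin m) ℝ) :
    lossOne S₀ X = frobNorm X ^ 2 + Matrix.trace S₀ -
      2 * Matrix.trace (CFC.sqrt (CFC.sqrt S₀ * X * (CFC.sqrt S₀ * X)ᵀ)) := by
  rw [lossOne, buresSq, Matrix.trace_sub, Matrix.trace_add, Matrix.trace_smul, smul_eq_mul,
    Matrix.transpose_mul, transpose_sqrt, frobNorm_sq_eq_trace_mul_transpose]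
  simp only [Matrix.mul_assoc]

lemma frobNorm_sqrt_sq (hS₀ : S₀.PosSemidef) : frobNorm (CFC.sqrt S₀) ^ 2 = Matrix.trace S₀ := by
  rw [frobNorm_sq, transpose_sqrt, hS₀.sqrt_mul_sqrt]

lemma frobNorm_sq_eq_of_mul_transpose_eq {Y : Matrix (Fin n) (Fin m) ℝ} (hY : Y * Yᵀ = S₀) :
    frobNorm Y ^ 2 = Matrix.trace S₀ := by
  rw [frobNorm_sq_eq_trace_mul_transpose, hY]

lemma frobNorm_sub_sq (A B : Matrix (Fin n) (Fin m) ℝ) :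
    frobNorm (A - B) ^ 2 = frobNorm A ^ 2 - 2 * Matrix.trace (Aᵀ * B) + frobNorm B ^ 2 := by
  rw [sub_eq_add_neg, frobNorm_add_sq, frobNorm_neg]
  simp
  ring

/-- The loss is the squared distance to the matrices `Y` with `Y Yᵀ = Σ₀`: upper bound. -/
lemma lossOne_le_frobNorm_sub_sq (hS₀ : S₀.PosSemidef) (X Q : Matrix (Fin n) (Fin m) ℝ)
    (hQ : Q * Qᵀ = 1) : lossOne S₀ X ≤ frobNorm (X - CFC.sqrt S₀ * Q) ^ 2 := by
  have h := trace_mul_transpose_le_trace_sqrt (CFC.sqrt S₀ * X) Q hQ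
  have hY : CFC.sqrt S₀ * Q * (CFC.sqrt S₀ * Q)ᵀ = S₀ := by
    rw [Matrix.transpose_mul, transpose_sqrt, Matrix.mul_assoc, ← Matrix.mul_assoc Q, hQ,
      Matrix.one_mul, hS₀.sqrt_mul_sqrt]
  have e : Matrix.trace (Xᵀ * (CFC.sqrt S₀ * Q)) = Matrix.trace (CFC.sqrt S₀ * X * Qᵀ) := by
    rw [trace_transpose_mul_comm, Matrix.transpose_mul, transpose_sqrt, Matrix.mul_assoc,
      Matrix.trace_mul_comm]
  rw [lossOne_eq, frobNorm_sub_sq, frobNorm_sq_eq_of_mul_transpose_eq hY, e]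
  linarith

/-- At `X` of full row rank the loss is the squared distance to some `Y` with `Y Yᵀ = Σ₀`, and it
is differentiable with gradient `2 (X - Y)`, which is expressed by quadratic bounds. -/
lemma exists_lossOne_eq (hS₀ : S₀.PosDef) {X : Matrix (Fin n) (Fin m) ℝ} (hX : (X * Xᵀ).PosDef) :
    ∃ Y : Matrix (Fin n) (Fin m) ℝ, ∃ C : ℝ, Y * Yᵀ = S₀ ∧
      (∀ (p : ℕ) (V : Matrix (Fin m) (Fin p) ℝ), X * V * Vᵀ = X → Y * V * Vᵀ = Y) ∧
      lossOne S₀ X = frobNorm (X - Y) ^ 2 ∧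
      (∀ X' : Matrix (Fin n) (Fin m) ℝ, lossOne S₀ X' ≤ frobNorm (X' - Y) ^ 2) ∧
      ∀ X' : Matrix (Fin n) (Fin m) ℝ,
        frobNorm (X' - Y) ^ 2 - C * frobNorm (X' - X) ^ 2 ≤ lossOne S₀ X' := by
  set B := CFC.sqrt S₀ with hB
  have hBt : Bᵀ = B := transpose_sqrt S₀
  have hBB : B * B = S₀ := hS₀.posSemidef.sqrt_mul_sqrt
  have hP : ((B * X) * (B * X)ᵀ).PosDef := by
    have := hX.mul_mul_conjTranspose_same (B := B)
      (Matrix.vecMul_injective_iff_isUnit.2 hS₀.sqrt.isUnit)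
    simpa [Matrix.transpose_mul, Matrix.mul_assoc] using this
  set R := CFC.sqrt ((B * X) * (B * X)ᵀ)
  have hR : R.PosDef := hP.sqrt
  have hRR : R * R = (B * X) * (B * X)ᵀ := hP.posSemidef.sqrt_mul_sqrt
  have hRt : Rᵀ = R := transpose_sqrt _
  -- Polar decomposition `B X = R Q`. The nearest point is `Y = B Q`.
  set Q := R⁻¹ * (B * X) with hQdef
  have hQ : Q * Qᵀ = 1 := by
    rw [hQdef, Matrix.transpose_mul, Matrix.transpose_nonsing_inv, hRt, Matrix.mul_assoc,
      ← Matrix.mul_assoc (B * X), ← hRR, ← Matrix.mul_assoc, ← Matrix.mul_assoc R⁻¹,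
      hR.inv_mul_self, Matrix.one_mul, hR.mul_inv_self]
  have hY : B * Q * (B * Q)ᵀ = S₀ := by
    rw [Matrix.transpose_mul, hBt, Matrix.mul_assoc, ← Matrix.mul_assoc Q, hQ,
      Matrix.one_mul, hBB]
  have hpair : ∀ Z : Matrix (Fin n) (Fin m) ℝ,
      Matrix.trace (Zᵀ * (B * Q)) = Matrix.trace (R⁻¹ * (B * X) * (B * Z)ᵀ) := fun Z => by
    rw [← hQdef, Matrix.transpose_mul, hBt, ← Matrix.mul_assoc, Matrix.trace_mul_comm]
  have hXQ : Matrix.trace (Xᵀ * (B * Q)) = Matrix.trace R := by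
    rw [hpair, Matrix.mul_assoc, ← hRR, ← Matrix.mul_assoc, hR.inv_mul_self, Matrix.one_mul]
  have hup := fun X' => lossOne_le_frobNorm_sub_sq hS₀.posSemidef X' Q hQ
  refine ⟨B * Q, ‖R⁻¹‖ * ‖B‖ ^ 2, hY, ?_, ?_, hup, fun X' => ?_⟩
  -- The rows of `Q`, hence of `Y`, lie in the row space of `X`. This later allows `Y` to be
  -- factored through the embedding of the input layer.
  · intro p V hV
    simp only [hQdef, Matrix.mul_assoc] at hV ⊢
    rw [hV]
  · rw [lossOne_eq, frobNorm_sub_sq, frobNorm_sq_eq_of_mul_transpose_eq hY, hXQ]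
    ring
  · obtain ⟨H, rfl⟩ : ∃ H, X' = X + H := ⟨X' - X, by abel⟩
    rw [add_sub_cancel_left, lossOne_eq, frobNorm_sub_sq, frobNorm_sq_eq_of_mul_transpose_eq hY]
    -- The weight `R⁻¹` gives equality at `H = 0`, so the first order terms in `H` cancel and only a
    -- quadratic error remains.
    have h1 := two_mul_trace_sqrt_le (posSemidef_mul_transpose (B * (X + H))) hR.inv
    rw [Matrix.nonsing_inv_nonsing_inv _ ((Matrix.isUnit_iff_isUnit_det _).1 hR.isUnit)] at h1
    have e1 : Matrix.trace (R⁻¹ * ((B * (X + H)) * (B * (X + H))ᵀ)) = Matrix.trace R +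
        2 * Matrix.trace (Hᵀ * (B * Q)) + Matrix.trace (R⁻¹ * ((B * H) * (B * H)ᵀ)) := by
      have e2 : Matrix.trace (R⁻¹ * ((B * H) * (B * X)ᵀ)) =
          Matrix.trace (R⁻¹ * (B * X) * (B * H)ᵀ) := by
        rw [← Matrix.trace_transpose]
        simp only [Matrix.transpose_mul, Matrix.transpose_transpose, Matrix.transpose_nonsing_inv,
          hRt]
        rw [Matrix.trace_mul_comm]
        simp only [Matrix.mul_assoc]
      have e3 : Matrix.trace (R⁻¹ * ((B * X) * (B * X)ᵀ)) = Matrix.trace R := by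
        rw [← hRR, ← Matrix.mul_assoc, hR.inv_mul_self, Matrix.one_mul]
      rw [hpair]
      simp only [Matrix.mul_add, Matrix.transpose_add, Matrix.add_mul, Matrix.trace_add]
      rw [e2, e3, ← Matrix.mul_assoc R⁻¹ (B * X)]
      ring
    have e4 : Matrix.trace (R⁻¹ * ((B * H) * (B * H)ᵀ)) ≤
        ‖R⁻¹‖ * ‖B‖ ^ 2 * frobNorm H ^ 2 := by
      have h2 := trace_transpose_mul_le (B * H) (R⁻¹ * (B * H))
      have h3 := frobNorm_mul_le R⁻¹ (B * H)
      have h4 := frobNorm_mul_le B H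
      rw [← Matrix.mul_assoc, Matrix.trace_mul_comm]
      calc _ ≤ frobNorm (B * H) * frobNorm (R⁻¹ * (B * H)) := h2
        _ ≤ frobNorm (B * H) * (‖R⁻¹‖ * frobNorm (B * H)) := by
          gcongr
          exact frobNorm_nonneg _
        _ = ‖R⁻¹‖ * frobNorm (B * H) ^ 2 := by ring
        _ ≤ ‖R⁻¹‖ * (‖B‖ * frobNorm H) ^ 2 := by
          gcongr
          exact frobNorm_nonneg _
        _ = _ := by ring
    have e5 : Matrix.trace ((X + H)ᵀ * (B * Q)) =
        Matrix.trace R + Matrix.trace (Hᵀ * (B * Q)) := by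
      rw [Matrix.transpose_add, Matrix.add_mul, Matrix.trace_add, hXQ]
    rw [e5]
    rw [e1] at h1
    linarith

end Loss

/-! ### The derivative of the loss with respect to the layers. -/

section Gradient

variable {N : ℕ} {d : ℕ → ℕ}

/-- The product `W_N ⋯ W_{k+1}` of the layers above the first `k`. -/
def suffixProd (W : Params N d) {k : ℕ} (hk : k ≤ N) : Matrix (Fin (d N)) (Fin (d k)) ℝ :=
  Nat.decreasingInduction (motive := fun k _ => Matrix (Fin (d N)) (Fin (d k)) ℝ)
    (fun k h A => A * W ⟨k, h⟩) 1 hk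

lemma suffixProd_self (W : Params N d) : suffixProd W le_rfl = 1 :=
  Nat.decreasingInduction_self _ _

lemma suffixProd_of_lt (W : Params N d) {k : ℕ} (hk : k < N) :
    suffixProd W hk.le = suffixProd W (Nat.succ_le_of_lt hk) * W ⟨k, hk⟩ :=
  Nat.decreasingInduction_succ_left _ _ _ _

lemma suffixProd_mul_partialProd (W : Params N d) {k : ℕ} (hk : k ≤ N) :
    suffixProd W hk * partialProd W k hk = endToEnd W := by
  induction hk using Nat.decreasingInduction with
  | self => rw [suffixProd_self, Matrix.one_mul]; rfl
  | of_succ k hk ih =>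
    rw [← ih, suffixProd_of_lt W hk, Matrix.mul_assoc]
    rfl

lemma partialProd_congr {W W' : Params N d} {k : ℕ} (hk : k ≤ N)
    (h : ∀ i (hi : i < k), W ⟨i, hi.trans_le hk⟩ = W' ⟨i, hi.trans_le hk⟩) :
    partialProd W k hk = partialProd W' k hk := by
  induction k with
  | zero => rfl
  | succ k ih =>
    simp only [partialProd]
    rw [ih _ fun i hi => h i (hi.trans (Nat.lt_succ_self k)), h k (Nat.lt_succ_self k)]

lemma suffixProd_congr {W W' : Params N d} {k : ℕ} (hk : k ≤ N)
    (h : ∀ i (hi : i < N), k ≤ i → W ⟨i, hi⟩ = W' ⟨i, hi⟩) :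
    suffixProd W hk = suffixProd W' hk := by
  induction hk using Nat.decreasingInduction with
  | self => rw [suffixProd_self, suffixProd_self]
  | of_succ k hk ih =>
    rw [suffixProd_of_lt W hk, suffixProd_of_lt W' hk, h k hk le_rfl,
      ih fun i hi hki => h i hi ((Nat.le_succ k).trans hki)]

lemma endToEnd_add_single (W : Params N d) (j : Fin N)
    (E : Matrix (Fin (d (j + 1))) (Fin (d j)) ℝ) :
    endToEnd (W + (Pi.single j E : Params N d)) = endToEnd W +
      suffixProd W (Nat.succ_le_of_lt j.2) * E * partialProd W j j.2.le := by
  have hne : ∀ i : Fin N, i ≠ j → (W + (Pi.single j E : Params N d)) i = W i := fun i hi => by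
    rw [Pi.add_apply, Pi.single_eq_of_ne hi, add_zero]
  have h1 : partialProd (W + (Pi.single j E : Params N d)) j j.2.le = partialProd W j j.2.le :=
    partialProd_congr _ fun i hi => hne _ fun h => by
      have := congrArg Fin.val h
      simp only at this
      omega
  have h2 : suffixProd (W + (Pi.single j E : Params N d)) (Nat.succ_le_of_lt j.2) =
      suffixProd W (Nat.succ_le_of_lt j.2) :=
    suffixProd_congr _ fun i hi hji => hne _ fun h => by
      have := congrArg Fin.val h
      simp only at this
      omega
  rw [← suffixProd_mul_partialProd (W + (Pi.single j E : Params N d)) j.2.le,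
    ← suffixProd_mul_partialProd W j.2.le, suffixProd_of_lt _ j.2, suffixProd_of_lt _ j.2, h1, h2]
  simp [Matrix.mul_add, Matrix.add_mul]

lemma differentiable_endToEnd :
    Differentiable ℝ (endToEnd : Params N d → Matrix (Fin (d N)) (Fin (d 0)) ℝ) := by
  have key : ∀ (k : ℕ) (hk : k ≤ N) a b,
      Differentiable ℝ fun W : Params N d => partialProd W k hk a b := by
    intro k hk
    induction k with
    | zero => exact fun a b => differentiable_const _
    | succ k ih =>
      intro a b
      simp only [partialProd, Matrix.mul_apply]
      refine Differentiable.fun_sum fun i _ => Differentiable.mul ?_ (ih _ i b)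
      exact (LinearMap.toContinuousLinearMap
        (⟨⟨fun W => W ⟨k, hk⟩ a i, fun _ _ => rfl⟩, fun _ _ => rfl⟩ :
          Params N d →ₗ[ℝ] ℝ)).differentiable
  have : (endToEnd : Params N d → Matrix (Fin (d N)) (Fin (d 0)) ℝ) = fun W =>
      ∑ a, ∑ b, partialProd W N le_rfl a b • Matrix.single a b (1 : ℝ) := by
    funext W
    conv_lhs => rw [Matrix.matrix_eq_sum_single (endToEnd W)]
    simp [endToEnd]
  rw [this]
  exact Differentiable.fun_sum fun a _ => Differentiable.fun_sum fun b _ =>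
    (key N le_rfl a b).smul_const _

set_option maxHeartbeats 2000000 in
-- `f` is squeezed between two quadratics that agree at `X` to first order, so it inherits their
-- derivative.
lemma hasFDerivAt_of_quadratic_bounds {n m : ℕ} {f : Matrix (Fin n) (Fin m) ℝ → ℝ}
    {X Y : Matrix (Fin n) (Fin m) ℝ} {C : ℝ} (h0 : f X = frobNorm (X - Y) ^ 2)
    (hup : ∀ X', f X' ≤ frobNorm (X' - Y) ^ 2)
    (hlow : ∀ X', frobNorm (X' - Y) ^ 2 - C * frobNorm (X' - X) ^ 2 ≤ f X') :
    HasFDerivAt f (LinearMap.toContinuousLinearMap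
      ((2 : ℝ) • (Matrix.traceLinearMap (Fin m) ℝ ℝ ∘ₗ
        mulLeftLinearMap (Fin m) ℝ (X - Y)ᵀ))) X := by
  set ℓ := LinearMap.toContinuousLinearMap ((2 : ℝ) • (Matrix.traceLinearMap (Fin m) ℝ ℝ ∘ₗ
        mulLeftLinearMap (Fin m) ℝ (X - Y)ᵀ))
  have hℓ : ∀ H, ℓ H = 2 * Matrix.trace ((X - Y)ᵀ * H) := fun H => rfl
  have hO : (fun X' => f X' - f X - ℓ (X' - X)) =O[nhds X] fun X' => ‖X' - X‖ ^ 2 := by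
    -- The ambient norm is the operator norm; the factor `frobNorm 1` converts Frobenius norms into
    -- it.
    refine Asymptotics.IsBigO.of_bound ((1 + |C|) * frobNorm (1 : Matrix (Fin n) (Fin n) ℝ) ^ 2)
      (Filter.Eventually.of_forall fun X' => ?_)
    have e := frobNorm_add_sq (X - Y) (X' - X)
    rw [show X - Y + (X' - X) = X' - Y by abel] at e
    have h1 := hup X'
    have h2 := hlow X'
    have h3 : frobNorm (X' - X) ^ 2 ≤
        frobNorm (1 : Matrix (Fin n) (Fin n) ℝ) ^ 2 * ‖X' - X‖ ^ 2 := by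
      have := pow_le_pow_left₀ (frobNorm_nonneg _)
        (frobNorm_mul_le' (1 : Matrix (Fin n) (Fin n) ℝ) (X' - X)) 2
      rwa [Matrix.one_mul, mul_pow] at this
    have h4 : |f X' - f X - ℓ (X' - X)| ≤ (1 + |C|) * frobNorm (X' - X) ^ 2 := by
      rw [hℓ, h0, abs_le]
      have := sq_nonneg (frobNorm (X' - X))
      have := mul_le_mul_of_nonneg_right (le_abs_self C) this
      have := mul_nonneg (abs_nonneg C) (sq_nonneg (frobNorm (X' - X)))
      constructor <;> nlinarith
    rw [Real.norm_eq_abs, Real.norm_of_nonneg (sq_nonneg _), mul_assoc]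
    exact h4.trans (mul_le_mul_of_nonneg_left h3 (by positivity))
  have h1 := hO.hasFDerivAt (𝕜 := ℝ) (by norm_num : 1 < 2)
  have h2 : HasFDerivAt (fun X' => ℓ (X' - X)) ℓ X :=
    ℓ.hasFDerivAt.comp X ((hasFDerivAt_id X).sub_const X)
  have h3 := (h1.add h2).add_const (f X)
  rw [zero_add] at h3
  exact h3.congr_of_eventuallyEq (Filter.Eventually.of_forall fun X' => by simp)

lemma trace_mul_single_mul {n m p q : ℕ} (Z : Matrix (Fin p) (Fin q) ℝ)
    (A : Matrix (Fin p) (Fin n) ℝ) (a : Fin n) (b : Fin m) (B : Matrix (Fin m) (Fin q) ℝ) :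
    Matrix.trace (Zᵀ * (A * Matrix.single a b (1 : ℝ) * B)) = (Aᵀ * Z * Bᵀ) a b := by
  have : Matrix.trace (Zᵀ * (A * Matrix.single a b (1 : ℝ) * B)) =
      Matrix.trace ((Aᵀ * Z * Bᵀ)ᵀ * Matrix.single a b (1 : ℝ)) := by
    simp only [Matrix.transpose_mul, Matrix.transpose_transpose, Matrix.mul_assoc]
    rw [Matrix.trace_mul_comm B]
    simp only [Matrix.mul_assoc]
  rw [this, Matrix.trace_mul_single]
  simp

variable {S₀ : Matrix (Fin (d N)) (Fin (d N)) ℝ} {W : Params N d}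
  {Y : Matrix (Fin (d N)) (Fin (d 0)) ℝ} {C : ℝ}

lemma differentiableAt_lossN (h0 : lossOne S₀ (endToEnd W) = frobNorm (endToEnd W - Y) ^ 2)
    (hup : ∀ X', lossOne S₀ X' ≤ frobNorm (X' - Y) ^ 2)
    (hlow : ∀ X', frobNorm (X' - Y) ^ 2 - C * frobNorm (X' - endToEnd W) ^ 2 ≤ lossOne S₀ X') :
    DifferentiableAt ℝ (lossN S₀ : Params N d → ℝ) W :=
  (hasFDerivAt_of_quadratic_bounds h0 hup hlow).differentiableAt.comp W
    differentiable_endToEnd.differentiableAt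

/-- The product is affine in each single layer, so a partial derivative of `L^N` is the derivative
of `L¹` along a straight line. -/
lemma gradLossN_apply (h0 : lossOne S₀ (endToEnd W) = frobNorm (endToEnd W - Y) ^ 2)
    (hup : ∀ X', lossOne S₀ X' ≤ frobNorm (X' - Y) ^ 2)
    (hlow : ∀ X', frobNorm (X' - Y) ^ 2 - C * frobNorm (X' - endToEnd W) ^ 2 ≤ lossOne S₀ X')
    (j : Fin N) :
    gradLossN S₀ W j = (2 : ℝ) • ((suffixProd W (Nat.succ_le_of_lt j.2))ᵀ * (endToEnd W - Y) *
      (partialProd W j j.2.le)ᵀ) := by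
  ext a b
  have hd := differentiableAt_lossN h0 hup hlow
  set Z := suffixProd W (Nat.succ_le_of_lt j.2) * Matrix.single a b (1 : ℝ) *
    partialProd W j j.2.le with hZ
  have h1 : HasDerivAt (fun t : ℝ => lossN S₀ (W + t • (Pi.single j (Matrix.single a b (1 : ℝ)) : Params N d)))
      (fderiv ℝ (lossN S₀ : Params N d → ℝ) W (Pi.single j (Matrix.single a b (1 : ℝ)))) 0 :=
    hd.hasFDerivAt.hasLineDerivAt _
  have h2 := (hasFDerivAt_of_quadratic_bounds h0 hup hlow).hasLineDerivAt Z
  have e : (fun t : ℝ => lossN S₀ (W + t • (Pi.single j (Matrix.single a b (1 : ℝ)) : Params N d))) =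
      fun t : ℝ => lossOne S₀ (endToEnd W + t • Z) := by
    funext t
    rw [lossN, ← Pi.single_smul, endToEnd_add_single, hZ, Matrix.mul_smul, Matrix.smul_mul]
  rw [e] at h1
  have h3 := h1.unique h2
  rw [gradLossN, Matrix.of_apply, h3]
  change 2 * Matrix.trace ((endToEnd W - Y)ᵀ * Z) = _
  rw [hZ, trace_mul_single_mul]
  simp

end Gradient

/-! ### Products of square layers: perturbation, gradient bounds and imbalance. -/

section Products

variable {n : ℕ}

/-- The product `w_{k-1} ⋯ w_0`. -/
def prefixMul (w : ℕ → Matrix (Fin n) (Fin n) ℝ) : ℕ → Matrix (Fin n) (Fin n) ℝ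
  | 0 => 1
  | k + 1 => w k * prefixMul w k

/-- The product `w_{k+l-1} ⋯ w_k` of `l` consecutive matrices. -/
def segmentMul (w : ℕ → Matrix (Fin n) (Fin n) ℝ) : ℕ → ℕ → Matrix (Fin n) (Fin n) ℝ
  | _, 0 => 1
  | k, l + 1 => segmentMul w (k + 1) l * w k

/-- The derivative of `prefixMul` at `w` in the direction `h`. -/
def prefixMulDeriv (w h : ℕ → Matrix (Fin n) (Fin n) ℝ) : ℕ → Matrix (Fin n) (Fin n) ℝ
  | 0 => 0
  | k + 1 => w k * prefixMulDeriv w h k + h k * prefixMul w k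

lemma segmentMul_succ (w : ℕ → Matrix (Fin n) (Fin n) ℝ) (k l : ℕ) :
    segmentMul w k (l + 1) = w (k + l) * segmentMul w k l := by
  induction l generalizing k with
  | zero => simp [segmentMul]
  | succ l ih =>
    rw [segmentMul, ih, segmentMul, Matrix.mul_assoc]
    congr 2
    omega

lemma prefixMulDeriv_eq_sum (w h : ℕ → Matrix (Fin n) (Fin n) ℝ) (k : ℕ) :
    prefixMulDeriv w h k =
      ∑ j ∈ Finset.range k, segmentMul w (j + 1) (k - 1 - j) * h j * prefixMul w j := by
  induction k with
  | zero => rfl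
  | succ k ih =>
    rw [prefixMulDeriv, ih, Finset.sum_range_succ, Finset.mul_sum]
    congr 1
    · refine Finset.sum_congr rfl fun j hj => ?_
      have hj := Finset.mem_range.1 hj
      rw [show k + 1 - 1 - j = (k - 1 - j) + 1 by omega, segmentMul_succ,
        show j + 1 + (k - 1 - j) = k by omega]
      simp only [Matrix.mul_assoc]
    · simp [segmentMul]

lemma norm_one_le : ‖(1 : Matrix (Fin n) (Fin n) ℝ)‖ ≤ 1 :=
  norm_le_of_dotProduct_mulVec_self_le zero_le_one fun v => by simp

variable {w h : ℕ → Matrix (Fin n) (Fin n) ℝ} {N : ℕ} {m a : ℝ}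

lemma norm_prefixMul_le (hm : 0 ≤ m) (hw : ∀ j < N, ‖w j‖ ≤ m) {k : ℕ} (hk : k ≤ N) :
    ‖prefixMul w k‖ ≤ m ^ k := by
  induction k with
  | zero => simpa [prefixMul] using norm_one_le
  | succ k ih =>
    rw [prefixMul, pow_succ']
    exact (norm_mul_le _ _).trans (mul_le_mul (hw k hk) (ih (by omega)) (norm_nonneg _) hm)

lemma norm_segmentMul_le (hm : 0 ≤ m) (hw : ∀ j < N, ‖w j‖ ≤ m) {k l : ℕ} (hk : k + l ≤ N) :
    ‖segmentMul w k l‖ ≤ m ^ l := by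
  induction l generalizing k with
  | zero => simpa [segmentMul] using norm_one_le
  | succ l ih =>
    rw [segmentMul, pow_succ]
    exact (norm_mul_le _ _).trans
      (mul_le_mul (ih (by omega)) (hw k (by omega)) (norm_nonneg _) (by positivity))

/-- The layers are perturbed one at a time. The factor `m + a` on the left stands for the exponent
`k - 1`, which would be truncated at `k = 0`. -/
lemma frobNorm_prefixMul_add_sub_le (hm : 0 ≤ m) (ha : 0 ≤ a) (hw : ∀ j < N, ‖w j‖ ≤ m)
    (hh : ∀ j < N, frobNorm (h j) ≤ a) {k : ℕ} (hk : k ≤ N) :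
    frobNorm (prefixMul (w + h) k - prefixMul w k) * (m + a) ≤ k * a * (m + a) ^ k := by
  have hwh : ∀ j < N, ‖(w + h) j‖ ≤ m + a := fun j hj =>
    (norm_add_le _ _).trans (add_le_add (hw j hj) ((norm_le_frobNorm _).trans (hh j hj)))
  induction k with
  | zero => simp [prefixMul, frobNorm_zero]
  | succ k ih =>
    have e : prefixMul (w + h) (k + 1) - prefixMul w (k + 1) =
        w k * (prefixMul (w + h) k - prefixMul w k) + h k * prefixMul (w + h) k := by
      simp only [prefixMul, Pi.add_apply, Matrix.mul_sub, Matrix.add_mul]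
      abel
    have h1 := ih (by omega)
    have h2 : frobNorm (w k * (prefixMul (w + h) k - prefixMul w k)) ≤
        m * frobNorm (prefixMul (w + h) k - prefixMul w k) :=
      (frobNorm_mul_le _ _).trans
        (mul_le_mul_of_nonneg_right (hw k (by omega)) (frobNorm_nonneg _))
    have h3 : frobNorm (h k * prefixMul (w + h) k) ≤ a * (m + a) ^ k :=
      (frobNorm_mul_le' _ _).trans (mul_le_mul (hh k (by omega))
        (norm_prefixMul_le (by positivity) hwh (by omega)) (norm_nonneg _) ha)
    rw [e]
    have h4 := (frobNorm_add_le (w k * (prefixMul (w + h) k - prefixMul w k))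
      (h k * prefixMul (w + h) k)).trans (add_le_add h2 h3)
    calc _ ≤ (m * frobNorm (prefixMul (w + h) k - prefixMul w k) + a * (m + a) ^ k) * (m + a) :=
          mul_le_mul_of_nonneg_right h4 (by positivity)
      _ = m * (frobNorm (prefixMul (w + h) k - prefixMul w k) * (m + a)) +
          a * (m + a) ^ (k + 1) := by ring
      _ ≤ (m + a) * (k * a * (m + a) ^ k) + a * (m + a) ^ (k + 1) := by
          gcongr
          · exact mul_nonneg (frobNorm_nonneg _) (by positivity)
          · linarith
      _ = _ := by push_cast; ring

/-- Taylor remainder of order two: `k (k - 1) / 2` counts pairs of perturbed layers, and `(m + a) ^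
2` on the left replaces the exponent `k - 2`. -/
lemma frobNorm_prefixMul_add_sub_sub_le (hm : 0 ≤ m) (ha : 0 ≤ a) (hw : ∀ j < N, ‖w j‖ ≤ m)
    (hh : ∀ j < N, frobNorm (h j) ≤ a) {k : ℕ} (hk : k ≤ N) :
    frobNorm (prefixMul (w + h) k - prefixMul w k - prefixMulDeriv w h k) * (m + a) ^ 2 ≤
      k * (k - 1) / 2 * a ^ 2 * (m + a) ^ k := by
  induction k with
  | zero => simp [prefixMul, prefixMulDeriv, frobNorm_zero]
  | succ k ih =>
    set R := prefixMul (w + h) k - prefixMul w k - prefixMulDeriv w h k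
    have e : prefixMul (w + h) (k + 1) - prefixMul w (k + 1) - prefixMulDeriv w h (k + 1) =
        w k * R + h k * (prefixMul (w + h) k - prefixMul w k) := by
      simp only [R, prefixMul, prefixMulDeriv, Pi.add_apply, Matrix.mul_sub, Matrix.add_mul]
      abel
    have h1 := ih (by omega)
    have h0 := frobNorm_prefixMul_add_sub_le hm ha hw hh (show k ≤ N by omega)
    have h2 : frobNorm (w k * R) ≤ m * frobNorm R :=
      (frobNorm_mul_le _ _).trans
        (mul_le_mul_of_nonneg_right (hw k (by omega)) (frobNorm_nonneg _))
    have h3 : frobNorm (h k * (prefixMul (w + h) k - prefixMul w k)) ≤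
        a * frobNorm (prefixMul (w + h) k - prefixMul w k) :=
      (frobNorm_mul_le _ _).trans (mul_le_mul_of_nonneg_right
        ((norm_le_frobNorm _).trans (hh k (by omega))) (frobNorm_nonneg _))
    have h4 := (frobNorm_add_le (w k * R)
      (h k * (prefixMul (w + h) k - prefixMul w k))).trans (add_le_add h2 h3)
    rw [e]
    calc _ ≤ (m * frobNorm R + a * frobNorm (prefixMul (w + h) k - prefixMul w k)) *
          (m + a) ^ 2 := mul_le_mul_of_nonneg_right h4 (by positivity)
      _ = m * (frobNorm R * (m + a) ^ 2) +
          a * (m + a) * (frobNorm (prefixMul (w + h) k - prefixMul w k) * (m + a)) := by ring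
      _ ≤ (m + a) * (k * (k - 1) / 2 * a ^ 2 * (m + a) ^ k) +
          a * (m + a) * (k * a * (m + a) ^ k) := by
          have := mul_nonneg (frobNorm_nonneg R) (sq_nonneg (m + a))
          gcongr
          linarith
      _ = _ := by push_cast; ring

lemma pow_mul_frobNorm_sq_le_segmentMul {s : ℝ} (hs : 0 ≤ s)
    (hw : ∀ j < N, s • (1 : Matrix (Fin n) (Fin n) ℝ) ≤ w j * (w j)ᵀ) {k l : ℕ} (hk : k + l ≤ N)
    {p : ℕ} (Z : Matrix (Fin n) (Fin p) ℝ) :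
    s ^ l * frobNorm Z ^ 2 ≤ frobNorm ((segmentMul w k l)ᵀ * Z) ^ 2 := by
  induction l generalizing k with
  | zero => simp [segmentMul]
  | succ l ih =>
    have h1 := mul_frobNorm_sq_le (A := (w k)ᵀ) (by simpa using hw k (by omega))
      ((segmentMul w (k + 1) l)ᵀ * Z)
    rw [segmentMul, Matrix.transpose_mul, Matrix.mul_assoc]
    calc _ = s * (s ^ l * frobNorm Z ^ 2) := by ring
      _ ≤ s * frobNorm ((segmentMul w (k + 1) l)ᵀ * Z) ^ 2 :=
        mul_le_mul_of_nonneg_left (ih (by omega)) hs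
      _ ≤ _ := h1

lemma pow_mul_frobNorm_sq_le_prefixMul {s : ℝ} (hs : 0 ≤ s)
    (hw : ∀ j < N, s • (1 : Matrix (Fin n) (Fin n) ℝ) ≤ (w j)ᵀ * w j) {k : ℕ} (hk : k ≤ N)
    {p : ℕ} (Z : Matrix (Fin p) (Fin n) ℝ) :
    s ^ k * frobNorm Z ^ 2 ≤ frobNorm (Z * (prefixMul w k)ᵀ) ^ 2 := by
  induction k with
  | zero => simp [prefixMul]
  | succ k ih =>
    have h1 := mul_frobNorm_sq_le (hw k (by omega)) (prefixMul w k * Zᵀ)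
    rw [← frobNorm_transpose (Z * _), Matrix.transpose_mul, Matrix.transpose_transpose] at ih ⊢
    rw [prefixMul, Matrix.mul_assoc]
    calc _ = s * (s ^ k * frobNorm Z ^ 2) := by ring
      _ ≤ s * frobNorm (prefixMul w k * Zᵀ) ^ 2 := mul_le_mul_of_nonneg_left (ih (by omega)) hs
      _ ≤ _ := h1

/-- The gradient of `w ↦ ‖w_{N-1} ⋯ w_0 - y‖²` with respect to `w_j`. -/
def distGrad (w : ℕ → Matrix (Fin n) (Fin n) ℝ) (N : ℕ) (y : Matrix (Fin n) (Fin n) ℝ) (j : ℕ) :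
    Matrix (Fin n) (Fin n) ℝ :=
  (2 : ℝ) • ((segmentMul w (j + 1) (N - 1 - j))ᵀ * (prefixMul w N - y) * (prefixMul w j)ᵀ)

variable {y : Matrix (Fin n) (Fin n) ℝ}

/-- The first order decrease of the squared distance along a gradient step. -/
lemma trace_prefixMulDeriv_distGrad (η : ℝ) :
    2 * Matrix.trace ((prefixMul w N - y)ᵀ *
      prefixMulDeriv w (fun j => -(η • distGrad w N y j)) N) =
      -(η * ∑ j ∈ Finset.range N, frobNorm (distGrad w N y j) ^ 2) := by
  rw [prefixMulDeriv_eq_sum, Finset.mul_sum, Matrix.trace_sum, Finset.mul_sum, Finset.mul_sum,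
    ← Finset.sum_neg_distrib]
  refine Finset.sum_congr rfl fun j _ => ?_
  set A := segmentMul w (j + 1) (N - 1 - j)
  set B := prefixMul w j
  set z := prefixMul w N - y
  set G := distGrad w N y j
  have hG : G = (2 : ℝ) • (Aᵀ * z * Bᵀ) := rfl
  have e : Matrix.trace (zᵀ * (A * G * B)) = Matrix.trace ((Aᵀ * z * Bᵀ)ᵀ * G) := by
    simp only [Matrix.transpose_mul, Matrix.transpose_transpose, Matrix.mul_assoc]
    rw [Matrix.trace_mul_comm B]
    simp only [Matrix.mul_assoc]
  have e2 : frobNorm G ^ 2 = 2 * Matrix.trace ((Aᵀ * z * Bᵀ)ᵀ * G) := by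
    rw [frobNorm_sq]
    conv_lhs => rw [hG, Matrix.transpose_smul, Matrix.smul_mul, ← hG, Matrix.trace_smul]
    rfl
  have e3 : A * -(η • G) * B = -(η • (A * G * B)) := by simp
  rw [e3, Matrix.mul_neg, Matrix.mul_smul, Matrix.trace_neg, Matrix.trace_smul, e, e2, smul_eq_mul]
  ring

lemma frobNorm_distGrad_le (hm : 0 ≤ m) (hw : ∀ j < N, ‖w j‖ ≤ m) {j : ℕ} (hj : j < N) :
    frobNorm (distGrad w N y j) ≤ 2 * m ^ (N - 1) * frobNorm (prefixMul w N - y) := by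
  rw [distGrad, frobNorm_smul, abs_two, mul_assoc (2 : ℝ)]
  refine mul_le_mul_of_nonneg_left ?_ (by norm_num)
  have h1 := norm_segmentMul_le hm hw (show j + 1 + (N - 1 - j) ≤ N by omega)
  have h2 := norm_prefixMul_le hm hw hj.le
  rw [← norm_transpose] at h1 h2
  have e : m ^ (N - 1) = m ^ (N - 1 - j) * m ^ j := by
    rw [← pow_add]
    congr 1
    omega
  calc _ ≤ frobNorm ((segmentMul w (j + 1) (N - 1 - j))ᵀ * (prefixMul w N - y)) *
        ‖(prefixMul w j)ᵀ‖ := frobNorm_mul_le' _ _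
    _ ≤ ‖(segmentMul w (j + 1) (N - 1 - j))ᵀ‖ * frobNorm (prefixMul w N - y) *
        ‖(prefixMul w j)ᵀ‖ := by
      gcongr
      exact frobNorm_mul_le _ _
    _ ≤ m ^ (N - 1 - j) * frobNorm (prefixMul w N - y) * m ^ j := by
      have := frobNorm_nonneg (prefixMul w N - y)
      gcongr
    _ = _ := by rw [e]; ring

/-- The Polyak–Łojasiewicz inequality, layer by layer: the residual is multiplied by `N - 1` layers
in all, each of which shrinks squared Frobenius norms by at most the factor `s`. -/
lemma le_frobNorm_distGrad_sq {s : ℝ} (hs : 0 ≤ s)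
    (hw : ∀ j < N, s • (1 : Matrix (Fin n) (Fin n) ℝ) ≤ w j * (w j)ᵀ)
    (hw' : ∀ j < N, s • (1 : Matrix (Fin n) (Fin n) ℝ) ≤ (w j)ᵀ * w j) {j : ℕ} (hj : j < N) :
    4 * s ^ (N - 1) * frobNorm (prefixMul w N - y) ^ 2 ≤ frobNorm (distGrad w N y j) ^ 2 := by
  have h1 := pow_mul_frobNorm_sq_le_segmentMul hs hw
    (show j + 1 + (N - 1 - j) ≤ N by omega) (prefixMul w N - y)
  have h2 := pow_mul_frobNorm_sq_le_prefixMul hs hw' hj.le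
    ((segmentMul w (j + 1) (N - 1 - j))ᵀ * (prefixMul w N - y))
  rw [distGrad, frobNorm_smul, mul_pow, abs_two]
  have e : s ^ (N - 1) = s ^ j * s ^ (N - 1 - j) := by
    rw [← pow_add]
    congr 1
    omega
  have h3 := mul_le_mul_of_nonneg_left h1 (pow_nonneg hs j)
  rw [e]
  linarith

/-- The failure of balancedness between the layers `j` and `j + 1`. -/
def imbalance (w : ℕ → Matrix (Fin n) (Fin n) ℝ) (j : ℕ) : Matrix (Fin n) (Fin n) ℝ :=
  w j * (w j)ᵀ - (w (j + 1))ᵀ * w (j + 1)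

lemma transpose_imbalance (w : ℕ → Matrix (Fin n) (Fin n) ℝ) (j : ℕ) :
    (imbalance w j)ᵀ = imbalance w j := by
  simp [imbalance]

/-- The terms linear in `η` cancel because `w_j G_jᵀ = G_{j+1}ᵀ w_{j+1}`, the discrete trace of the
conservation law of gradient flow. -/
lemma imbalance_step (η : ℝ) {j : ℕ} (hj : j + 1 < N) :
    imbalance (w + fun j => -(η • distGrad w N y j)) j = imbalance w j +
      η ^ 2 • (distGrad w N y j * (distGrad w N y j)ᵀ -
        (distGrad w N y (j + 1))ᵀ * distGrad w N y (j + 1)) := by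
  have e : w j * (distGrad w N y j)ᵀ = (distGrad w N y (j + 1))ᵀ * w (j + 1) := by
    rw [distGrad, distGrad, show N - 1 - j = (N - 1 - (j + 1)) + 1 by omega]
    simp only [segmentMul, prefixMul, Matrix.transpose_smul, Matrix.transpose_mul,
      Matrix.transpose_transpose, Matrix.mul_smul, Matrix.smul_mul, Matrix.mul_assoc]
  have e' : distGrad w N y j * (w j)ᵀ = (w (j + 1))ᵀ * distGrad w N y (j + 1) := by
    have := congrArg Matrix.transpose e
    simpa using this
  simp only [imbalance, Pi.add_apply, Matrix.transpose_add, Matrix.transpose_neg,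
    Matrix.transpose_smul, Matrix.add_mul, Matrix.mul_add, Matrix.mul_neg, Matrix.neg_mul,
    Matrix.mul_smul, Matrix.smul_mul, e, e']
  module

/-- Each layer belongs to at most two consecutive pairs, hence the factor `2`. -/
lemma sum_norm_imbalance_step_le (η : ℝ) :
    ∑ j ∈ Finset.range (N - 1), ‖imbalance (w + fun j => -(η • distGrad w N y j)) j‖ ≤
      ∑ j ∈ Finset.range (N - 1), ‖imbalance w j‖ +
        2 * η ^ 2 * ∑ j ∈ Finset.range N, frobNorm (distGrad w N y j) ^ 2 := by
  have h1 : ∀ j ∈ Finset.range (N - 1),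
      ‖imbalance (w + fun j => -(η • distGrad w N y j)) j‖ ≤ ‖imbalance w j‖ +
        η ^ 2 * (frobNorm (distGrad w N y j) ^ 2 + frobNorm (distGrad w N y (j + 1)) ^ 2) := by
    intro j hj
    have hj := Finset.mem_range.1 hj
    rw [imbalance_step η (show j + 1 < N by omega)]
    have h2 : ∀ i, ‖distGrad w N y i‖ * ‖distGrad w N y i‖ ≤ frobNorm (distGrad w N y i) ^ 2 :=
      fun i => by
        rw [sq]
        exact mul_self_le_mul_self (norm_nonneg _) (norm_le_frobNorm _)
    have h3 := norm_mul_le (distGrad w N y j) (distGrad w N y j)ᵀ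
    have h4 := norm_mul_le (distGrad w N y (j + 1))ᵀ (distGrad w N y (j + 1))
    rw [norm_transpose] at h3 h4
    refine (norm_add_le _ _).trans (add_le_add_right ?_ _)
    rw [norm_smul, Real.norm_of_nonneg (sq_nonneg η)]
    refine mul_le_mul_of_nonneg_left ((norm_sub_le _ _).trans ?_) (sq_nonneg η)
    exact add_le_add (h3.trans (h2 _)) (h4.trans (h2 _))
  refine (Finset.sum_le_sum h1).trans ?_
  rw [Finset.sum_add_distrib, ← Finset.mul_sum, Finset.sum_add_distrib]
  have h5 : ∑ j ∈ Finset.range (N - 1), frobNorm (distGrad w N y j) ^ 2 ≤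
      ∑ j ∈ Finset.range N, frobNorm (distGrad w N y j) ^ 2 :=
    Finset.sum_le_sum_of_subset_of_nonneg (Finset.range_mono (Nat.sub_le _ _))
      fun _ _ _ => sq_nonneg _
  have h6 : ∑ j ∈ Finset.range (N - 1), frobNorm (distGrad w N y (j + 1)) ^ 2 ≤
      ∑ j ∈ Finset.range N, frobNorm (distGrad w N y j) ^ 2 := by
    rcases N with _ | N
    · simp
    · rw [Finset.sum_range_succ']
      simp only [Nat.add_sub_cancel]
      have := sq_nonneg (frobNorm (distGrad w (N + 1) y 0))
      linarith
  nlinarith [sq_nonneg η]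

end Products

/-! ### Singular values of almost balanced layers. -/

section Balance

variable {n : ℕ} {w : ℕ → Matrix (Fin n) (Fin n) ℝ}

lemma norm_mul_transpose_self (A : Matrix (Fin n) (Fin n) ℝ) : ‖A * Aᵀ‖ = ‖A‖ ^ 2 := by
  have := Matrix.l2_opNorm_conjTranspose_mul_self Aᵀ
  rw [Matrix.conjTranspose_eq_transpose_of_trivial, Matrix.transpose_transpose, norm_transpose]
    at this
  rw [this, sq]

lemma norm_transpose_mul_self (A : Matrix (Fin n) (Fin n) ℝ) : ‖Aᵀ * A‖ = ‖A‖ ^ 2 := by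
  simpa [norm_transpose] using norm_mul_transpose_self Aᵀ

lemma norm_pow_sub_pow_le {R : Type*} [NormedRing R] {P Q : R} {r : ℝ} (hr : 0 ≤ r)
    (hP : ‖P‖ ≤ r) (hQ : ‖Q‖ ≤ r) (k : ℕ) :
    ‖P ^ (k + 1) - Q ^ (k + 1)‖ ≤ (k + 1) * r ^ k * ‖P - Q‖ := by
  induction k with
  | zero => simp
  | succ k ih =>
    have e : P ^ (k + 1 + 1) - Q ^ (k + 1 + 1) =
        P * (P ^ (k + 1) - Q ^ (k + 1)) + (P - Q) * Q ^ (k + 1) := by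
      rw [pow_succ' P, pow_succ' Q (k + 1)]
      noncomm_ring
    have hQk : ‖Q ^ (k + 1)‖ ≤ r ^ (k + 1) :=
      (norm_pow_le' Q (Nat.succ_pos k)).trans (pow_le_pow_left₀ (norm_nonneg _) hQ _)
    rw [e]
    calc _ ≤ ‖P‖ * ‖P ^ (k + 1) - Q ^ (k + 1)‖ + ‖P - Q‖ * ‖Q ^ (k + 1)‖ :=
          (norm_add_le _ _).trans (add_le_add (norm_mul_le _ _) (norm_mul_le _ _))
      _ ≤ r * ((k + 1) * r ^ k * ‖P - Q‖) + ‖P - Q‖ * r ^ (k + 1) := by gcongr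
      _ = _ := by push_cast; ring

/-- The end-to-end Gram matrix is close to a power of the Gram matrix of the last layer. -/
lemma norm_prefixMul_mul_transpose_sub_pow_le {r : ℝ} (hr : 0 ≤ r) {k : ℕ}
    (hw : ∀ j ≤ k, ‖w j‖ ^ 2 ≤ r) :
    ‖prefixMul w (k + 1) * (prefixMul w (k + 1))ᵀ - (w k * (w k)ᵀ) ^ (k + 1)‖ ≤
      k * r ^ k * ∑ j ∈ Finset.range k, ‖imbalance w j‖ := by
  induction k with
  | zero => simp [prefixMul]
  | succ k ih =>
    have ih := ih fun j hj => hw j (by omega)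
    set P := prefixMul w (k + 1) * (prefixMul w (k + 1))ᵀ
    set A := w (k + 1)
    set a := w k * (w k)ᵀ
    have hA : ‖A‖ ^ 2 ≤ r := hw (k + 1) le_rfl
    have e1 : prefixMul w (k + 1 + 1) * (prefixMul w (k + 1 + 1))ᵀ = A * P * Aᵀ := by
      simp only [P, A, prefixMul, Matrix.transpose_mul, Matrix.mul_assoc]
    -- With the outer layer peeled off on both sides, it remains to compare powers of `w_k w_kᵀ` and
    -- `AᵀA`, which differ by one imbalance.
    have e2 : (A * Aᵀ) ^ (k + 1 + 1) = A * (Aᵀ * A) ^ (k + 1) * Aᵀ := by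
      rw [← mul_pow_mul, pow_succ]
      simp only [mul_assoc]
    have e3 : imbalance w k = a - Aᵀ * A := rfl
    have h1 : ‖a ^ (k + 1) - (Aᵀ * A) ^ (k + 1)‖ ≤ (k + 1) * r ^ k * ‖imbalance w k‖ := by
      rw [e3]
      refine norm_pow_sub_pow_le hr ?_ ?_ k
      · rw [norm_mul_transpose_self]
        exact hw k (by omega)
      · rw [norm_transpose_mul_self]
        exact hA
    have e4 : A * P * Aᵀ - A * (Aᵀ * A) ^ (k + 1) * Aᵀ =
        A * (P - a ^ (k + 1) + (a ^ (k + 1) - (Aᵀ * A) ^ (k + 1))) * Aᵀ := by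
      simp [Matrix.mul_sub, Matrix.sub_mul]
    rw [e1, e2, e4]
    set S := ∑ j ∈ Finset.range k, ‖imbalance w j‖ with hS
    calc _ ≤ ‖A‖ * ‖P - a ^ (k + 1) + (a ^ (k + 1) - (Aᵀ * A) ^ (k + 1))‖ * ‖Aᵀ‖ :=
          (norm_mul_le _ _).trans (mul_le_mul_of_nonneg_right (norm_mul_le _ _) (norm_nonneg _))
      _ = ‖A‖ ^ 2 * ‖P - a ^ (k + 1) + (a ^ (k + 1) - (Aᵀ * A) ^ (k + 1))‖ := by
          rw [norm_transpose]
          ring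
      _ ≤ r * (k * r ^ k * S + (k + 1) * r ^ k * ‖imbalance w k‖) :=
          mul_le_mul hA ((norm_add_le _ _).trans (add_le_add ih h1)) (norm_nonneg _) hr
      _ ≤ _ := by
          rw [Finset.sum_range_succ, ← hS]
          have : 0 ≤ r ^ (k + 1) * S :=
            mul_nonneg (pow_nonneg hr _) (Finset.sum_nonneg fun _ _ => norm_nonneg _)
          push_cast
          rw [pow_succ] at *
          nlinarith

lemma norm_sq_le_add_sum_imbalance {k j : ℕ} (hj : j ≤ k) :
    ‖w j‖ ^ 2 ≤ ‖w k‖ ^ 2 + ∑ i ∈ Finset.range k, ‖imbalance w i‖ := by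
  have key : ‖w j‖ ^ 2 + ∑ i ∈ Finset.range j, ‖imbalance w i‖ ≤
      ‖w k‖ ^ 2 + ∑ i ∈ Finset.range k, ‖imbalance w i‖ := by
    induction k, hj using Nat.le_induction with
    | base => rfl
    | succ k hk ih =>
      have e : w k * (w k)ᵀ = (w (k + 1))ᵀ * w (k + 1) + imbalance w k := by
        rw [imbalance]
        abel
      have h := norm_add_le ((w (k + 1))ᵀ * w (k + 1)) (imbalance w k)
      rw [← e, norm_mul_transpose_self, norm_transpose_mul_self] at h
      rw [Finset.sum_range_succ]
      linarith
  have : 0 ≤ ∑ i ∈ Finset.range j, ‖imbalance w i‖ := Finset.sum_nonneg fun _ _ => norm_nonneg _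
  linarith

/-- Going down one layer costs one imbalance. The partial sum on the left is the budget still to be
spent; it keeps the bound positive, as the exchange of `w wᵀ` and `wᵀ w` requires. -/
lemma smul_one_le_mul_transpose_of_last {s : ℝ} (hs : 0 < s) {k : ℕ}
    (hk : (s + ∑ i ∈ Finset.range k, ‖imbalance w i‖) • (1 : Matrix (Fin n) (Fin n) ℝ) ≤
      w k * (w k)ᵀ) {j : ℕ} (hj : j ≤ k) :
    (s + ∑ i ∈ Finset.range j, ‖imbalance w i‖) • (1 : Matrix (Fin n) (Fin n) ℝ) ≤
      w j * (w j)ᵀ := by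
  induction hj using Nat.decreasingInduction with
  | self => exact hk
  | of_succ j hj ih =>
    have e : w j * (w j)ᵀ = (w (j + 1))ᵀ * w (j + 1) + imbalance w j := by
      rw [imbalance]
      abel
    have hpos : 0 < s + ∑ i ∈ Finset.range (j + 1), ‖imbalance w i‖ :=
      add_pos_of_pos_of_nonneg hs (Finset.sum_nonneg fun _ _ => norm_nonneg _)
    have h1 : (s + ∑ i ∈ Finset.range (j + 1), ‖imbalance w i‖) •
        (1 : Matrix (Fin n) (Fin n) ℝ) ≤ (w (j + 1))ᵀ * w (j + 1) := by
      simpa using smul_one_le_mul_transpose (A := (w (j + 1))ᵀ) hpos (by simpa using ih)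
    have h2 := add_le_add h1 (neg_norm_smul_one_le (transpose_imbalance w j))
    rw [e]
    refine le_trans (le_of_eq ?_) h2
    rw [Finset.sum_range_succ]
    module

/-- Bernoulli's inequality for `1 - δ / r`. -/
lemma sub_pow_ge {r δ : ℝ} {N : ℕ} (hN : 1 ≤ N) (hr : 0 < r) (hδr : δ ≤ r) :
    r ^ (N - 1) * (r - N * δ) ≤ (r - δ) ^ N := by
  have h := one_add_mul_le_pow (a := -(δ / r)) (by
    have : δ / r ≤ 1 := (div_le_one hr).2 hδr
    linarith) N
  have e : (r - δ) ^ N = r ^ N * (1 + -(δ / r)) ^ N := by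
    rw [← mul_pow]
    congr 1
    field_simp
    ring
  have e2 : r ^ (N - 1) * (r - N * δ) = r ^ N * (1 + N * -(δ / r)) := by
    obtain ⟨p, rfl⟩ := Nat.exists_eq_add_of_le' hN
    rw [Nat.add_sub_cancel, pow_succ]
    field_simp
    ring
  rw [e, e2]
  exact mul_le_mul_of_nonneg_left h (by positivity)

/-- Let `r` be the largest squared layer norm. The last layer has squared norm at least `r - δ`, and
the `(k+1)`-st power of its Gram matrix is within `k r^k δ` of that of the product, so `(r -
δ)^(k+1) ≤ X + k r^k δ`. By Bernoulli `r^k (r - 2(k+1)δ) ≤ X`. If `r > m`, the left side exceeds its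
value at `m`, which is at least `X`. -/
lemma norm_sq_le_of_imbalance {k : ℕ} {m X δ : ℝ} (hm : 0 < m)
    (hδ : ∑ i ∈ Finset.range k, ‖imbalance w i‖ ≤ δ)
    (hX : ‖prefixMul w (k + 1)‖ ^ 2 ≤ X)
    (h : X + 2 * (k + 1) * δ * m ^ k ≤ m ^ (k + 1)) {j : ℕ} (hj : j ≤ k) : ‖w j‖ ^ 2 ≤ m := by
  have hδ0 : 0 ≤ δ := (Finset.sum_nonneg fun _ _ => norm_nonneg _).trans hδ
  have hX0 : 0 ≤ X := (sq_nonneg _).trans hX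
  obtain ⟨i, hi, hmax⟩ := Finset.exists_max_image (Finset.range (k + 1)) (fun j => ‖w j‖ ^ 2)
    ⟨0, by simp⟩
  set r := ‖w i‖ ^ 2
  have hik : i ≤ k := by simpa [Nat.lt_succ_iff] using hi
  have hr : ∀ j ≤ k, ‖w j‖ ^ 2 ≤ r := fun j hj => hmax j (by simpa [Nat.lt_succ_iff] using hj)
  refine (hr j hj).trans ?_
  by_contra! hrm
  have hr0 : 0 < r := hm.trans hrm
  have hmk : 0 < m ^ k := pow_pos hm k
  have hmδ : 2 * (k + 1) * δ ≤ m := by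
    have : (2 * (k + 1) * δ) * m ^ k ≤ m * m ^ k := by
      rw [pow_succ'] at h
      linarith
    exact le_of_mul_le_mul_right this hmk
  have hk0 : (0 : ℝ) ≤ k := Nat.cast_nonneg k
  have hδr : δ ≤ r := by nlinarith
  set K := X + k * r ^ k * δ
  have hK : 0 ≤ K := by positivity
  -- `K` bounds the norm of the Gram power, so its root bounds the Gram matrix of the last layer.
  set β := K ^ ((((k + 1 : ℕ) : ℝ))⁻¹)
  have hβ0 : 0 ≤ β := Real.rpow_nonneg hK _
  have hβ : β ^ (k + 1) = K := Real.rpow_inv_natCast_pow hK (Nat.succ_ne_zero k)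
  have hE := norm_prefixMul_mul_transpose_sub_pow_le hr0.le hr
  have hE' : ‖prefixMul w (k + 1) * (prefixMul w (k + 1))ᵀ - (w k * (w k)ᵀ) ^ (k + 1)‖ ≤
      k * r ^ k * δ := hE.trans (by gcongr)
  have h1 : ‖(w k * (w k)ᵀ) ^ (k + 1)‖ ≤ β ^ (k + 1) := by
    rw [hβ]
    have := norm_sub_le (prefixMul w (k + 1) * (prefixMul w (k + 1))ᵀ)
      (prefixMul w (k + 1) * (prefixMul w (k + 1))ᵀ - (w k * (w k)ᵀ) ^ (k + 1))
    rw [sub_sub_cancel, norm_mul_transpose_self] at this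
    linarith
  have h2 : (w k * (w k)ᵀ) ^ (k + 1) ≤ β ^ (k + 1) • (1 : Matrix (Fin n) (Fin n) ℝ) := by
    have hpos : (0 : Matrix (Fin n) (Fin n) ℝ) ≤ 1 :=
      Matrix.nonneg_iff_posSemidef.2 Matrix.PosSemidef.one
    refine (le_norm_smul_one (by simp)).trans ?_
    rw [Matrix.le_iff, ← sub_smul]
    exact Matrix.PosSemidef.one.smul (sub_nonneg.2 h1)
  have h3 := le_smul_one_of_pow_le (by simp) (Nat.succ_ne_zero k) hβ0 h2
  have h4 : ‖w k‖ ^ 2 ≤ β := by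
    have := (mul_transpose_self_le_smul_one_iff (A := w k) (Real.sqrt_nonneg β)).1
      (by rwa [Real.sq_sqrt hβ0])
    calc ‖w k‖ ^ 2 ≤ Real.sqrt β ^ 2 := pow_le_pow_left₀ (norm_nonneg _) this 2
      _ = β := Real.sq_sqrt hβ0
  have h5 : r - δ ≤ β := by
    have := norm_sq_le_add_sum_imbalance (w := w) hik
    linarith
  have h6 : (r - δ) ^ (k + 1) ≤ K := by
    rw [← hβ]
    exact pow_le_pow_left₀ (by linarith) h5 _
  have h7 := sub_pow_ge (N := k + 1) (by omega) hr0 hδr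
  rw [Nat.add_sub_cancel] at h7
  push_cast at h7
  have h8 : r ^ k * (r - 2 * (k + 1) * δ) ≤ X := by
    have : 0 ≤ r ^ k * δ := by positivity
    simp only [K] at h6
    nlinarith
  have h9 : m ^ k ≤ r ^ k := pow_le_pow_left₀ hm.le hrm.le k
  have h10 : m ^ k * (m - 2 * (k + 1) * δ) < r ^ k * (r - 2 * (k + 1) * δ) := by
    refine mul_lt_mul' h9 (by linarith) (by linarith) (by positivity)
  rw [pow_succ] at h
  linarith

/-- The additional `δ` in the conclusion is the reserve needed to descend to the other layers.
Raising `κ + δ` to the power `k + 1` costs at most `(k+1) δ m^k`, and replacing the product by the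
Gram power costs `k δ m^k`; both fit into `2 (k+1) δ m^k`. -/
lemma le_last_of_imbalance {k : ℕ} {m X δ κ s : ℝ} (hm : 0 < m) (hκ : 0 < κ)
    (hδ : ∑ i ∈ Finset.range k, ‖imbalance w i‖ ≤ δ)
    (hX : ‖prefixMul w (k + 1)‖ ^ 2 ≤ X)
    (h : X + 2 * (k + 1) * δ * m ^ k ≤ m ^ (k + 1))
    (hs : s • (1 : Matrix (Fin n) (Fin n) ℝ) ≤ prefixMul w (k + 1) * (prefixMul w (k + 1))ᵀ)
    (h' : κ ^ (k + 1) + 2 * (k + 1) * δ * m ^ k ≤ s)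
    (hsX : s ≤ X) :
    (κ + δ) • (1 : Matrix (Fin n) (Fin n) ℝ) ≤ w k * (w k)ᵀ := by
  have hδ0 : 0 ≤ δ := (Finset.sum_nonneg fun _ _ => norm_nonneg _).trans hδ
  -- Combining `h'`, `s ≤ X` and `h` with Bernoulli gives `κ^(k+1) ≤ (m - δ)^(k+1)`.
  have h'' : κ + δ ≤ m := by
    have hX0 : 0 ≤ X := (sq_nonneg _).trans hX
    have hmk : 0 < m ^ k := pow_pos hm k
    have hk0 : (0 : ℝ) ≤ k := Nat.cast_nonneg k
    have hkδ : 0 ≤ k * (δ * m ^ k) := by positivity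
    have hδk : 0 ≤ δ * m ^ k := by positivity
    have hm' : m ^ (k + 1) = m * m ^ k := pow_succ' m k
    have hmδ : 2 * (k + 1) * δ ≤ m := le_of_mul_le_mul_right (by linarith) hmk
    have hδm : δ ≤ m := by nlinarith
    have h1 := sub_pow_ge (N := k + 1) (by omega) hm hδm
    rw [Nat.add_sub_cancel] at h1
    push_cast at h1
    have h2 : κ ^ (k + 1) ≤ (m - δ) ^ (k + 1) := by linarith
    have := le_of_pow_le_pow_left₀ (Nat.succ_ne_zero k) (by linarith) h2
    linarith
  have hE := norm_prefixMul_mul_transpose_sub_pow_le hm.le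
    fun j hj => norm_sq_le_of_imbalance hm hδ hX h hj
  have hE' : ‖prefixMul w (k + 1) * (prefixMul w (k + 1))ᵀ - (w k * (w k)ᵀ) ^ (k + 1)‖ ≤
      k * m ^ k * δ := hE.trans (by gcongr)
  refine smul_one_le_of_le_pow (N := k + 1)
    (Matrix.nonneg_iff_posSemidef.2 (posSemidef_mul_transpose _)) (Nat.succ_ne_zero k) ?_
  set P := prefixMul w (k + 1) * (prefixMul w (k + 1))ᵀ
  set a := (w k * (w k)ᵀ) ^ (k + 1)
  have h1 := le_norm_smul_one (A := P - a) (by simp [P, a])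
  have h2 : (κ + δ) ^ (k + 1) ≤ s - ‖P - a‖ := by
    have h3 : (κ + δ) ^ (k + 1) ≤ κ ^ (k + 1) + (k + 1) * δ * m ^ k := by
      have := sub_pow_ge (N := k + 1) (r := κ + δ) (δ := δ) (by omega) (by linarith)
        (by linarith)
      rw [Nat.add_sub_cancel, add_sub_cancel_right] at this
      push_cast at this
      have h4 : (κ + δ) ^ k ≤ m ^ k := pow_le_pow_left₀ (by linarith) h'' k
      have h5 : (κ + δ) ^ k * ((k + 1) * δ) ≤ m ^ k * ((k + 1) * δ) :=
        mul_le_mul_of_nonneg_right h4 (by positivity)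
      rw [pow_succ]
      linarith
    have : 0 ≤ m ^ k * δ := by positivity
    nlinarith
  have h3 : (κ + δ) ^ (k + 1) • (1 : Matrix (Fin n) (Fin n) ℝ) ≤ (s - ‖P - a‖) • 1 := by
    rw [Matrix.le_iff, ← sub_smul]
    exact Matrix.PosSemidef.one.smul (sub_nonneg.2 h2)
  refine h3.trans ?_
  rw [sub_smul, sub_le_iff_le_add]
  refine hs.trans ?_
  rw [← sub_le_iff_le_add']
  exact h1

/-- Layers that are almost balanced have all their singular values between the roots of bounds on
the singular values of their product. -/
lemma layer_bounds_of_imbalance {k : ℕ} {m X δ κ s : ℝ} (hm : 0 < m) (hκ : 0 < κ)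
    (hδ : ∑ i ∈ Finset.range k, ‖imbalance w i‖ ≤ δ)
    (hX : ‖prefixMul w (k + 1)‖ ^ 2 ≤ X)
    (h : X + 2 * (k + 1) * δ * m ^ k ≤ m ^ (k + 1))
    (hs : s • (1 : Matrix (Fin n) (Fin n) ℝ) ≤ prefixMul w (k + 1) * (prefixMul w (k + 1))ᵀ)
    (h' : κ ^ (k + 1) + 2 * (k + 1) * δ * m ^ k ≤ s)
    (hsX : s ≤ X) {j : ℕ} (hj : j ≤ k) :
    ‖w j‖ ^ 2 ≤ m ∧ κ • (1 : Matrix (Fin n) (Fin n) ℝ) ≤ w j * (w j)ᵀ ∧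
      κ • (1 : Matrix (Fin n) (Fin n) ℝ) ≤ (w j)ᵀ * w j := by
  have hmono : ∀ {a b : ℝ}, a ≤ b → a • (1 : Matrix (Fin n) (Fin n) ℝ) ≤ b • 1 := fun hab => by
    rw [Matrix.le_iff, ← sub_smul]
    exact Matrix.PosSemidef.one.smul (sub_nonneg.2 hab)
  have h1 := smul_one_le_mul_transpose_of_last hκ
    ((hmono (by linarith)).trans (le_last_of_imbalance hm hκ hδ hX h hs h' hsX)) hj
  have h2 : κ • (1 : Matrix (Fin n) (Fin n) ℝ) ≤ w j * (w j)ᵀ :=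
    (hmono (le_add_of_nonneg_right (Finset.sum_nonneg fun _ _ => norm_nonneg _))).trans h1
  refine ⟨norm_sq_le_of_imbalance hm hδ hX h hj, h2, ?_⟩
  simpa using smul_one_le_mul_transpose (A := (w j)ᵀ) hκ (by simpa using h2)

end Balance

/-! ### Decrease of the squared distance in one gradient step. -/

section DescentStep

/-- `(1 + a/m)^q ≤ exp (q a / m) ≤ exp (1/8) ≤ 1 / (1 - 1/8)`. -/
lemma add_pow_le_of_small_step {m a : ℝ} {q : ℕ} (hm : 0 < m) (ha : 0 ≤ a)
    (h : 8 * q * a ≤ m) : (m + a) ^ q ≤ 8 / 7 * m ^ q := by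
  have h1 : (1 + a / m) ^ q ≤ Real.exp (1 / 8) := by
    have h2 : (1 + a / m) ^ q ≤ Real.exp (a / m) ^ q :=
      pow_le_pow_left₀ (by positivity) (by linarith [Real.add_one_le_exp (a / m)]) q
    refine h2.trans ?_
    rw [← Real.exp_nat_mul]
    refine Real.exp_le_exp.2 ?_
    rw [← mul_div_assoc, div_le_iff₀ hm]
    linarith
  have h3 : Real.exp (1 / 8) ≤ 8 / 7 := by
    refine (Real.exp_bound_div_one_sub_of_interval (by norm_num) (by norm_num)).trans ?_
    norm_num
  have e : (m + a) ^ q = (1 + a / m) ^ q * m ^ q := by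
    rw [← mul_pow]
    congr 1
    field_simp
  rw [e]
  exact mul_le_mul_of_nonneg_right (h1.trans h3) (by positivity)

/-- Here `N = p + 2`, so that `m^(3p+2) = m^(3N-4)` and `κ^(2p+2) = κ^(2(N-1))`. The quantity `η (2
m^(p+1) e)` bounds the displacement of a layer in one step. -/
lemma step_le_of_stepsize {e F η m κ : ℝ} {p : ℕ} (he : 0 ≤ e) (heF : e ≤ F)
    (hκ : 0 < κ) (hκm : κ ≤ m)
    (hη : η * (16 * (p + 1) * m ^ (3 * p + 2) * F) ≤ κ ^ (2 * p + 2)) :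
    8 * (p + 1) * (η * (2 * m ^ (p + 1) * e)) ≤ m := by
  have hm : 0 < m := hκ.trans_le hκm
  have h1 : κ ^ (2 * p + 2) ≤ m ^ (2 * p + 2) := pow_le_pow_left₀ hκ.le hκm _
  have h2 : (8 * (p + 1) * (η * (2 * m ^ (p + 1) * F))) * m ^ (2 * p + 1) ≤
      m * m ^ (2 * p + 1) := by
    calc _ = η * (16 * (p + 1) * m ^ (3 * p + 2) * F) := by ring
      _ ≤ m ^ (2 * p + 2) := hη.trans h1
      _ = _ := by ring
  have h3 := le_of_mul_le_mul_right h2 (by positivity)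
  rcases le_or_gt η 0 with h | h
  · have : η * (2 * m ^ (p + 1) * e) ≤ 0 := mul_nonpos_of_nonpos_of_nonneg h (by positivity)
    nlinarith
  · refine le_trans ?_ h3
    gcongr

/-- The step size bound makes the terms of second order at most half the decrease of first
order. -/
lemma second_order_le {e F η m κ : ℝ} {p : ℕ} (he : 0 ≤ e) (heF : e ≤ F)
    (hη0 : 0 ≤ η) (hκ : 0 < κ) (hκm : κ ≤ m) (hmF : m ^ (p + 2) ≤ 2 * F)
    (hη : η * (16 * (p + 1) * m ^ (3 * p + 2) * F) ≤ κ ^ (2 * p + 2)) {a : ℝ}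
    (ha : a = η * (2 * m ^ (p + 1) * e)) :
    2 * e * ((p + 2) * (p + 1) / 2 * a ^ 2 * (m + a) ^ p) +
      ((p + 2) * a * (m + a) ^ (p + 1)) ^ 2 ≤ 2 * η * (p + 2) * κ ^ (2 * p + 2) * e ^ 2 := by
  have hm : 0 < m := hκ.trans_le hκm
  have ha0 : 0 ≤ a := by rw [ha]; positivity
  have hsmall := step_le_of_stepsize he heF hκ hκm hη
  rw [← ha] at hsmall
  have h1 : (m + a) ^ (p + 1) ≤ 8 / 7 * m ^ (p + 1) :=
    add_pow_le_of_small_step hm ha0 (by push_cast; exact hsmall)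
  have h2 : (m + a) ^ p ≤ 8 / 7 * m ^ p :=
    add_pow_le_of_small_step hm ha0 (by nlinarith)
  -- The Taylor remainder uses up `1/7` of the budget and the squared displacement `32/49`; together
  -- this is less than `1`.
  have h3 : 2 * e * ((p + 2) * (p + 1) / 2 * a ^ 2 * (m + a) ^ p) ≤
      2 * η * (p + 2) * e ^ 2 * (1 / 7 * κ ^ (2 * p + 2)) := by
    calc _ ≤ 2 * e * ((p + 2) * (p + 1) / 2 * a ^ 2 * (8 / 7 * m ^ p)) := by gcongr
      _ = 2 * η * (p + 2) * e ^ 2 * (1 / 7 * (η * (16 * (p + 1) * m ^ (3 * p + 2) * e))) := by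
        rw [ha]
        ring
      _ ≤ 2 * η * (p + 2) * e ^ 2 * (1 / 7 * (η * (16 * (p + 1) * m ^ (3 * p + 2) * F))) := by
        gcongr
      _ ≤ _ := by gcongr
  have h4 : ((p + 2) * a * (m + a) ^ (p + 1)) ^ 2 ≤
      2 * η * (p + 2) * e ^ 2 * (32 / 49 * κ ^ (2 * p + 2)) := by
    calc _ ≤ ((p + 2) * a * (8 / 7 * m ^ (p + 1))) ^ 2 := by gcongr
      _ = 2 * η * (p + 2) * e ^ 2 * (128 / 49 * (p + 2) * η * m ^ (3 * p + 2) * m ^ (p + 2)) := by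
        rw [ha]
        ring
      _ ≤ 2 * η * (p + 2) * e ^ 2 *
          (128 / 49 * (2 * (p + 1)) * η * m ^ (3 * p + 2) * (2 * F)) := by
        gcongr
        have : (0 : ℝ) ≤ p := Nat.cast_nonneg p
        linarith
      _ = 2 * η * (p + 2) * e ^ 2 * (32 / 49 * (η * (16 * (p + 1) * m ^ (3 * p + 2) * F))) := by
        ring
      _ ≤ _ := by gcongr
  have h5 : 0 ≤ 2 * η * (p + 2) * e ^ 2 * κ ^ (2 * p + 2) := by positivity
  nlinarith

variable {n : ℕ} {w : ℕ → Matrix (Fin n) (Fin n) ℝ} {y : Matrix (Fin n) (Fin n) ℝ}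

/-- One step of gradient descent for at least two layers. -/
lemma descent_step_of_layer_bounds {F η m κ : ℝ} {p : ℕ}
    (heF : frobNorm (prefixMul w (p + 2) - y) ≤ F)
    (hη0 : 0 ≤ η) (hκ : 0 < κ) (hκm : κ ≤ m) (hmF : m ^ (p + 2) ≤ 2 * F)
    (hη : η * (16 * (p + 1) * m ^ (3 * p + 2) * F) ≤ κ ^ (2 * p + 2))
    (hw : ∀ j < p + 2, ‖w j‖ ≤ m)
    (hw1 : ∀ j < p + 2, κ ^ 2 • (1 : Matrix (Fin n) (Fin n) ℝ) ≤ w j * (w j)ᵀ)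
    (hw2 : ∀ j < p + 2, κ ^ 2 • (1 : Matrix (Fin n) (Fin n) ℝ) ≤ (w j)ᵀ * w j) :
    4 * (p + 2) * κ ^ (2 * p + 2) * frobNorm (prefixMul w (p + 2) - y) ^ 2 ≤
        ∑ j ∈ Finset.range (p + 2), frobNorm (distGrad w (p + 2) y j) ^ 2 ∧
      frobNorm (prefixMul (w + fun j => -(η • distGrad w (p + 2) y j)) (p + 2) - y) ^ 2 ≤
        frobNorm (prefixMul w (p + 2) - y) ^ 2 -
          η / 2 * ∑ j ∈ Finset.range (p + 2), frobNorm (distGrad w (p + 2) y j) ^ 2 := by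
  have hm : 0 < m := hκ.trans_le hκm
  set x := prefixMul w (p + 2)
  set e := frobNorm (x - y)
  have he : 0 ≤ e := frobNorm_nonneg _
  set S := ∑ j ∈ Finset.range (p + 2), frobNorm (distGrad w (p + 2) y j) ^ 2
  set h : ℕ → Matrix (Fin n) (Fin n) ℝ := fun j => -(η • distGrad w (p + 2) y j)
  set a := η * (2 * m ^ (p + 1) * e) with ha
  have ha0 : 0 ≤ a := by positivity
  have hS : 4 * (p + 2) * κ ^ (2 * p + 2) * e ^ 2 ≤ S := by
    have h1 := Finset.sum_le_sum fun j (hj : j ∈ Finset.range (p + 2)) =>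
      le_frobNorm_distGrad_sq (y := y) (sq_nonneg κ) hw1 hw2 (Finset.mem_range.1 hj)
    rw [Finset.sum_const, Finset.card_range, nsmul_eq_mul] at h1
    refine le_trans (le_of_eq ?_) h1
    rw [show p + 2 - 1 = p + 1 by omega, ← pow_mul]
    push_cast
    ring
  refine ⟨hS, ?_⟩
  have hh : ∀ j < p + 2, frobNorm (h j) ≤ a := fun j hj => by
    simp only [h]
    rw [frobNorm_neg, frobNorm_smul, abs_of_nonneg hη0]
    exact mul_le_mul_of_nonneg_left (frobNorm_distGrad_le hm.le hw hj) hη0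
  have hd := frobNorm_prefixMul_add_sub_le hm.le ha0 hw hh (le_refl (p + 2))
  have hR := frobNorm_prefixMul_add_sub_sub_le hm.le ha0 hw hh (le_refl (p + 2))
  set x' := prefixMul (w + h) (p + 2)
  set R := x' - x - prefixMulDeriv w h (p + 2) with hRdef
  have hma : 0 < m + a := by linarith
  have hd' : frobNorm (x' - x) ≤ (p + 2) * a * (m + a) ^ (p + 1) := by
    refine le_of_mul_le_mul_right (hd.trans (le_of_eq ?_)) hma
    push_cast
    ring
  have hR' : frobNorm R ≤ (p + 2) * (p + 1) / 2 * a ^ 2 * (m + a) ^ p := by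
    refine le_of_mul_le_mul_right (hR.trans (le_of_eq ?_)) (pow_pos hma 2)
    push_cast
    ring
  have h1 := second_order_le he heF hη0 hκ hκm hmF hη ha
  have h2 : Matrix.trace ((x - y)ᵀ * R) ≤ e * frobNorm R := trace_transpose_mul_le _ _
  have h3 := trace_prefixMulDeriv_distGrad (w := w) (N := p + 2) (y := y) η
  have h4 : frobNorm (x' - y) ^ 2 = e ^ 2 + 2 * Matrix.trace ((x - y)ᵀ * (x' - x)) +
      frobNorm (x' - x) ^ 2 := by
    rw [← frobNorm_add_sq]
    congr 2
    abel
  have h5 : Matrix.trace ((x - y)ᵀ * (x' - x)) =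
      Matrix.trace ((x - y)ᵀ * prefixMulDeriv w h (p + 2)) + Matrix.trace ((x - y)ᵀ * R) := by
    rw [← Matrix.trace_add, ← Matrix.mul_add, hRdef]
    congr 2
    abel
  have h6 : frobNorm (x' - x) ^ 2 ≤ ((p + 2) * a * (m + a) ^ (p + 1)) ^ 2 :=
    pow_le_pow_left₀ (frobNorm_nonneg _) hd' 2
  have h7 : e * frobNorm R ≤ e * ((p + 2) * (p + 1) / 2 * a ^ 2 * (m + a) ^ p) :=
    mul_le_mul_of_nonneg_left hR' he
  -- By this inequality half of the first order decrease `η * S` dominates the bound `h1` for the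
  -- higher order terms; the other half is the claim.
  have h8 : η * (4 * (p + 2) * κ ^ (2 * p + 2) * e ^ 2) ≤ η * S :=
    mul_le_mul_of_nonneg_left hS hη0
  rw [h4, h5]
  linarith

/-- One step of gradient descent for a single layer. -/
lemma descent_step_single {η : ℝ} (hη0 : 0 ≤ η) (hη : η ≤ 1 / 4) :
    4 * frobNorm (prefixMul w 1 - y) ^ 2 ≤
        ∑ j ∈ Finset.range 1, frobNorm (distGrad w 1 y j) ^ 2 ∧
      frobNorm (prefixMul (w + fun j => -(η • distGrad w 1 y j)) 1 - y) ^ 2 ≤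
        frobNorm (prefixMul w 1 - y) ^ 2 -
          η / 2 * ∑ j ∈ Finset.range 1, frobNorm (distGrad w 1 y j) ^ 2 := by
  have e1 : distGrad w 1 y 0 = (2 : ℝ) • (w 0 - y) := by
    simp [distGrad, segmentMul, prefixMul]
  have e2 : w 0 + -(η • (2 : ℝ) • (w 0 - y)) - y = (1 - 2 * η) • (w 0 - y) := by module
  have e3 := sq_nonneg (frobNorm (w 0 - y))
  simp only [Finset.range_one, Finset.sum_singleton, prefixMul, Pi.add_apply, e1, Matrix.mul_one,
    e2, frobNorm_smul, mul_pow, sq_abs]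
  constructor
  · linarith
  · nlinarith [mul_nonneg hη0 e3, mul_nonneg (mul_nonneg hη0 e3) (sub_nonneg.2 hη)]

end DescentStep

/-! ### Propagation of the singular value bounds from the margin. -/

section Invariant

variable {n q : ℕ}

lemma posDef_of_smul_one_le {A : Matrix (Fin n) (Fin n) ℝ} {s : ℝ} (hs : 0 < s)
    (h : s • (1 : Matrix (Fin n) (Fin n) ℝ) ≤ A) : A.PosDef := by
  have h1 : (s • (1 : Matrix (Fin n) (Fin n) ℝ)).PosDef := Matrix.PosDef.one.smul hs
  simpa using h1.add_posSemidef (Matrix.le_iff.1 h)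

lemma smul_one_le_mul_transpose_iff {A : Matrix (Fin n) (Fin q) ℝ} {s : ℝ} (hs : 0 ≤ s) :
    s ^ 2 • (1 : Matrix (Fin n) (Fin n) ℝ) ≤ A * Aᵀ ↔
      ∀ v : EuclideanSpace ℝ (Fin n), s * ‖v‖ ≤ ‖Matrix.toEuclideanLin Aᵀ v‖ := by
  rw [le_iff_dotProduct (by simp) (by simp)]
  have e1 : ∀ v : EuclideanSpace ℝ (Fin n), ‖Matrix.toEuclideanLin Aᵀ v‖ ^ 2 =
      v.ofLp ⬝ᵥ ((A * Aᵀ) *ᵥ v.ofLp) := fun v => by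
    rw [EuclideanSpace.norm_sq_eq, ← Matrix.mulVec_mulVec, Matrix.dotProduct_mulVec,
      ← Matrix.mulVec_transpose]
    simp [dotProduct, sq, Matrix.toLpLin_apply]
  have e2 : ∀ v : EuclideanSpace ℝ (Fin n), (s * ‖v‖) ^ 2 =
      v.ofLp ⬝ᵥ ((s ^ 2 • (1 : Matrix (Fin n) (Fin n) ℝ)) *ᵥ v.ofLp) := fun v => by
    rw [mul_pow, EuclideanSpace.norm_sq_eq]
    simp only [Real.norm_eq_abs, sq_abs, dotProduct, Matrix.smul_mulVec, Matrix.one_mulVec,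
      Pi.smul_apply, smul_eq_mul, Finset.mul_sum]
    exact Finset.sum_congr rfl fun i _ => by ring
  constructor
  · intro h v
    refine le_of_sq_le_sq ?_ (norm_nonneg _)
    rw [e1, e2]
    exact h _
  · intro h v
    have := pow_le_pow_left₀ (by positivity) (h (WithLp.toLp 2 v)) 2
    rwa [e1, e2] at this

/-- Weyl's inequality for the smallest singular value, by the triangle inequality for `‖Yᵀ v‖`. -/
lemma smul_one_le_mul_transpose_of_sub {X Y : Matrix (Fin n) (Fin q) ℝ} {σ e : ℝ}
    (hY : σ ^ 2 • (1 : Matrix (Fin n) (Fin n) ℝ) ≤ Y * Yᵀ) (he : frobNorm (X - Y) ≤ e)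
    (heσ : e ≤ σ) : (σ - e) ^ 2 • (1 : Matrix (Fin n) (Fin n) ℝ) ≤ X * Xᵀ := by
  have hσ : 0 ≤ σ := (frobNorm_nonneg _).trans (he.trans heσ)
  rw [smul_one_le_mul_transpose_iff (sub_nonneg.2 heσ)]
  rw [smul_one_le_mul_transpose_iff hσ] at hY
  intro v
  have h1 : ‖Matrix.toEuclideanLin (Y - X)ᵀ v‖ ≤ e * ‖v‖ := by
    have h2 := Matrix.l2_opNorm_mulVec (Y - X)ᵀ v
    rw [norm_transpose] at h2
    refine le_trans h2 (mul_le_mul_of_nonneg_right ?_ (norm_nonneg _))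
    exact (norm_le_frobNorm _).trans (by rwa [frobNorm_sub_comm])
  have h3 : Matrix.toEuclideanLin Yᵀ v =
      Matrix.toEuclideanLin Xᵀ v + Matrix.toEuclideanLin (Y - X)ᵀ v := by
    rw [Matrix.transpose_sub, map_sub, LinearMap.sub_apply]
    abel
  have h4 := norm_add_le (Matrix.toEuclideanLin Xᵀ v) (Matrix.toEuclideanLin (Y - X)ᵀ v)
  rw [← h3] at h4
  linarith [hY v]

/-- The scalar assumptions on the initialization and the step size: `l ^ 2` is the initial loss,
`σ` the smallest singular value and `F` the Frobenius norm of `Σ₀^{1/2}`, and `κ ^ N`, `m ^ N` are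
lower and upper bounds for the singular values of the end-to-end matrix. -/
structure StepsizeBound (p : ℕ) (l σ F m κ η : ℝ) : Prop where
  l_nonneg : 0 ≤ l
  η_nonneg : 0 ≤ η
  κ_pos : 0 < κ
  m_pos : 0 < m
  margin : l + κ ^ (p + 2) ≤ σ
  σ_le : σ ≤ F
  m_pow : (m ^ (p + 2)) ^ 2 = 2 * (l ^ 2 + F ^ 2)
  η_le : η * (16 * (p + 1) * m ^ (3 * p + 2) * F) ≤ κ ^ (2 * p + 2)

namespace StepsizeBound

variable {p : ℕ} {l σ F m κ η : ℝ}

lemma κ_pow_le (h : StepsizeBound p l σ F m κ η) : κ ^ (p + 2) ≤ F := by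
  linarith [h.margin, h.l_nonneg, h.σ_le]

lemma F_pos (h : StepsizeBound p l σ F m κ η) : 0 < F :=
  (pow_pos h.κ_pos _).trans_le h.κ_pow_le

lemma l_le (h : StepsizeBound p l σ F m κ η) : l ≤ F := by
  linarith [h.margin, h.σ_le, pow_pos h.κ_pos (p + 2)]

lemma m_pow_le (h : StepsizeBound p l σ F m κ η) : m ^ (p + 2) ≤ 2 * F := by
  refine le_of_sq_le_sq ?_ (by linarith [h.F_pos])
  rw [h.m_pow]
  nlinarith [h.l_le, h.l_nonneg]

lemma κ_le (h : StepsizeBound p l σ F m κ η) : κ ≤ m := by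
  refine le_of_pow_le_pow_left₀ (n := p + 2) (by omega) h.m_pos.le (h.κ_pow_le.trans ?_)
  refine le_of_sq_le_sq ?_ (pow_pos h.m_pos _).le
  rw [h.m_pow]
  nlinarith [sq_nonneg l, sq_nonneg F]

lemma two_mul_l_le (h : StepsizeBound p l σ F m κ η) : 2 * l ≤ m ^ (p + 2) := by
  refine le_of_sq_le_sq ?_ (pow_pos h.m_pos _).le
  rw [h.m_pow]
  nlinarith [h.l_le, h.l_nonneg]

/-- The coefficient `q = 4 N η m^(2N-2)` converts the decrease of the loss into the perturbation
caused by imbalance. Its consequences `q ≤ 1` and `q m^N ≤ κ^N` serve the upper and the lower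
singular value bound respectively. -/
lemma coeff_mul_le (h : StepsizeBound p l σ F m κ η) :
    4 * (p + 2) * η * m ^ (2 * p + 2) * m ^ (2 * p + 2) ≤ κ ^ (2 * p + 2) := by
  have hη := h.η_nonneg
  have hm := h.m_pos
  have hF := h.F_pos
  have hp : (0 : ℝ) ≤ p := Nat.cast_nonneg p
  calc _ = 4 * (p + 2) * η * m ^ (3 * p + 2) * m ^ (p + 2) := by ring
    _ ≤ 4 * (2 * (p + 1)) * η * m ^ (3 * p + 2) * (2 * F) := by
      gcongr
      · linarith
      · exact h.m_pow_le
    _ = η * (16 * (p + 1) * m ^ (3 * p + 2) * F) := by ring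
    _ ≤ _ := h.η_le

lemma coeff_le_one (h : StepsizeBound p l σ F m κ η) :
    4 * (p + 2) * η * m ^ (2 * p + 2) ≤ 1 := by
  refine le_of_mul_le_mul_right (a := m ^ (2 * p + 2)) ?_ (pow_pos h.m_pos _)
  rw [one_mul]
  exact h.coeff_mul_le.trans (pow_le_pow_left₀ h.κ_pos.le h.κ_le _)

lemma coeff_mul_m_pow_le (h : StepsizeBound p l σ F m κ η) :
    4 * (p + 2) * η * m ^ (2 * p + 2) * m ^ (p + 2) ≤ κ ^ (p + 2) := by
  refine le_of_mul_le_mul_right (a := m ^ p) ?_ (pow_pos h.m_pos _)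
  calc _ = 4 * (p + 2) * η * m ^ (2 * p + 2) * m ^ (2 * p + 2) := by ring
    _ ≤ κ ^ (2 * p + 2) := h.coeff_mul_le
    _ = κ ^ (p + 2) * κ ^ p := by ring
    _ ≤ _ := by
      have := h.κ_pos
      gcongr
      exact h.κ_le

variable {w : ℕ → Matrix (Fin n) (Fin n) ℝ} {y : Matrix (Fin n) (Fin n) ℝ}

/-- Bounds for the singular values of the layers along gradient descent. -/
lemma layer_bounds (h : StepsizeBound p l σ F m κ η) (hyF : frobNorm y = F)
    (hyσ : σ ^ 2 • (1 : Matrix (Fin n) (Fin n) ℝ) ≤ y * yᵀ)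
    (he : frobNorm (prefixMul w (p + 2) - y) ≤ l)
    (hδ : ∑ j ∈ Finset.range (p + 1), ‖imbalance w j‖ ≤
      4 * η * (l ^ 2 - frobNorm (prefixMul w (p + 2) - y) ^ 2)) {j : ℕ} (hj : j < p + 2) :
    ‖w j‖ ≤ m ∧ κ ^ 2 • (1 : Matrix (Fin n) (Fin n) ℝ) ≤ w j * (w j)ᵀ ∧
      κ ^ 2 • (1 : Matrix (Fin n) (Fin n) ℝ) ≤ (w j)ᵀ * w j := by
  set x := prefixMul w (p + 2) with hx
  set e := frobNorm (x - y)
  have he0 : 0 ≤ e := frobNorm_nonneg _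
  have hκN := pow_pos h.κ_pos (p + 2)
  have hσ : e ≤ σ := by linarith [h.margin]
  have hs := smul_one_le_mul_transpose_of_sub (X := x) hyσ le_rfl hσ
  have hX : ‖x‖ ^ 2 ≤ (F + e) ^ 2 := by
    refine pow_le_pow_left₀ (norm_nonneg _) ?_ 2
    have h1 := frobNorm_add_le y (x - y)
    rw [add_sub_cancel, hyF] at h1
    exact (norm_le_frobNorm x).trans h1
  set q := 4 * (p + 2) * η * m ^ (2 * p + 2) with hq
  have hq0 : 0 ≤ q := by
    have := h.η_nonneg
    have := h.m_pos
    positivity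
  have hle : 0 ≤ l ^ 2 - e ^ 2 := by nlinarith
  have eq1 : 2 * (((p + 1 : ℕ) : ℝ) + 1) * (4 * η * (l ^ 2 - e ^ 2)) * (m ^ 2) ^ (p + 1) =
      2 * q * (l ^ 2 - e ^ 2) := by
    rw [hq, ← pow_mul]
    push_cast
    ring
  -- `(F + e)² ≤ 2F² + 2e²`, and since `q ≤ 1` the imbalance adds at most `2(l² - e²)`. The sum is
  -- exactly `2(l² + F²) = m^(2N)`.
  have H1 : (F + e) ^ 2 + 2 * (((p + 1 : ℕ) : ℝ) + 1) * (4 * η * (l ^ 2 - e ^ 2)) *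
      (m ^ 2) ^ (p + 1) ≤ (m ^ 2) ^ (p + 1 + 1) := by
    rw [eq1, ← pow_mul, mul_comm 2 (p + 1 + 1), pow_mul, show p + 1 + 1 = p + 2 by omega, h.m_pow]
    have := mul_le_mul_of_nonneg_right h.coeff_le_one hle
    nlinarith [sq_nonneg (F - e)]
  -- The margin gives `(σ - e)² ≥ (κ^N + (l - e))²`, whose cross term `2 κ^N (l - e)` absorbs the
  -- imbalance `2q(l - e)(l + e)`.
  have H2 : (κ ^ 2) ^ (p + 1 + 1) + 2 * (((p + 1 : ℕ) : ℝ) + 1) * (4 * η * (l ^ 2 - e ^ 2)) *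
      (m ^ 2) ^ (p + 1) ≤ (σ - e) ^ 2 := by
    rw [eq1, ← pow_mul, mul_comm 2 (p + 1 + 1), pow_mul, show p + 1 + 1 = p + 2 by omega]
    have h1 : q * (2 * l) ≤ κ ^ (p + 2) :=
      (mul_le_mul_of_nonneg_left h.two_mul_l_le hq0).trans h.coeff_mul_m_pow_le
    have h2 : 2 * q * (l ^ 2 - e ^ 2) ≤ 2 * κ ^ (p + 2) * (l - e) := by
      have h3 : q * (l + e) ≤ κ ^ (p + 2) :=
        (mul_le_mul_of_nonneg_left (by linarith) hq0).trans h1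
      have := mul_le_mul_of_nonneg_right h3 (sub_nonneg.2 he)
      nlinarith
    have h4 : (κ ^ (p + 2) + (l - e)) ^ 2 ≤ (σ - e) ^ 2 :=
      pow_le_pow_left₀ (by linarith) (by linarith [h.margin]) 2
    nlinarith [sq_nonneg (l - e)]
  have H3 : (σ - e) ^ 2 ≤ (F + e) ^ 2 :=
    pow_le_pow_left₀ (by linarith) (by linarith [h.σ_le]) 2
  obtain ⟨h1, h2, h3⟩ := layer_bounds_of_imbalance (k := p + 1) (pow_pos h.m_pos 2)
    (pow_pos h.κ_pos 2) hδ hX H1 hs H2 H3 (show j ≤ p + 1 by omega)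
  exact ⟨le_of_sq_le_sq h1 h.m_pos.le, h2, h3⟩

end StepsizeBound

end Invariant

/-! ### Reduction of balanced networks to square layers. -/

section SquareReduction

variable {N : ℕ} {d : ℕ → ℕ}

/-- The weights `W` arise from the square matrices `w` by isometric embeddings `U`. -/
structure IsEmbedding (U : (j : ℕ) → Matrix (Fin (d j)) (Fin (d N)) ℝ)
    (w : ℕ → Matrix (Fin (d N)) (Fin (d N)) ℝ) (W : Params N d) : Prop where
  isometry : ∀ j ≤ N, (U j)ᵀ * U j = 1
  last : U N = 1
  eq : ∀ (j : ℕ) (hj : j < N), W ⟨j, hj⟩ = U (j + 1) * w j * (U j)ᵀ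

lemma prefixMul_eq_segmentMul {n : ℕ} (w : ℕ → Matrix (Fin n) (Fin n) ℝ) (k : ℕ) :
    prefixMul w k = segmentMul w 0 k := by
  induction k with
  | zero => rfl
  | succ k ih => rw [segmentMul_succ, prefixMul, ih, zero_add]

namespace IsEmbedding

variable {U : (j : ℕ) → Matrix (Fin (d j)) (Fin (d N)) ℝ}
  {w : ℕ → Matrix (Fin (d N)) (Fin (d N)) ℝ} {W : Params N d}

lemma suffixProd_eq (h : IsEmbedding U w W) {k : ℕ} (hk : k ≤ N) :
    suffixProd W hk = segmentMul w k (N - k) * (U k)ᵀ := by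
  induction hk using Nat.decreasingInduction with
  | self => rw [suffixProd_self, h.last, Nat.sub_self]; simp [segmentMul]
  | of_succ k hk ih =>
    rw [suffixProd_of_lt W hk, ih, h.eq k hk, show N - k = N - (k + 1) + 1 by omega, segmentMul]
    have := h.isometry (k + 1) hk
    calc _ = segmentMul w (k + 1) (N - (k + 1)) * ((U (k + 1))ᵀ * U (k + 1)) * w k * (U k)ᵀ := by
          simp only [Matrix.mul_assoc]
      _ = _ := by rw [this, Matrix.mul_one]

/-- The empty product is the identity on the whole input space, which need not be the image of `U
0`; the identity therefore holds only after multiplication by `U 0`. -/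
lemma partialProd_mul_eq (h : IsEmbedding U w W) {k : ℕ} (hk : k ≤ N) :
    partialProd W k hk * U 0 = U k * prefixMul w k := by
  induction k with
  | zero => simp [partialProd, prefixMul]
  | succ k ih =>
    rw [partialProd, prefixMul, Matrix.mul_assoc, ih (by omega), h.eq k hk]
    calc _ = U (k + 1) * w k * ((U k)ᵀ * U k) * prefixMul w k := by simp only [Matrix.mul_assoc]
      _ = _ := by rw [h.isometry k (by omega), Matrix.mul_one, Matrix.mul_assoc]

lemma endToEnd_eq (h : IsEmbedding U w W) : endToEnd W = prefixMul w N * (U 0)ᵀ := by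
  rw [← suffixProd_mul_partialProd W (Nat.zero_le N), h.suffixProd_eq, Nat.sub_zero,
    prefixMul_eq_segmentMul]
  simp [partialProd]

lemma endToEnd_mul_transpose (h : IsEmbedding U w W) :
    endToEnd W * (endToEnd W)ᵀ = prefixMul w N * (prefixMul w N)ᵀ := by
  rw [h.endToEnd_eq, Matrix.transpose_mul, Matrix.transpose_transpose, Matrix.mul_assoc,
    ← Matrix.mul_assoc (U 0)ᵀ, h.isometry 0 (Nat.zero_le N), Matrix.one_mul]

end IsEmbedding

lemma frobNorm_mul_transpose_of_isometry {n p q : ℕ} (A : Matrix (Fin p) (Fin n) ℝ)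
    {U : Matrix (Fin q) (Fin n) ℝ} (hU : Uᵀ * U = 1) : frobNorm (A * Uᵀ) = frobNorm A := by
  rw [← Real.sqrt_sq (frobNorm_nonneg _), ← Real.sqrt_sq (frobNorm_nonneg A),
    frobNorm_sq_eq_trace_mul_transpose, frobNorm_sq_eq_trace_mul_transpose,
    Matrix.transpose_mul, Matrix.transpose_transpose, Matrix.mul_assoc, ← Matrix.mul_assoc Uᵀ, hU,
    Matrix.one_mul]

/-- The gradient at embedded weights is the embedding of the gradient of a squared distance. -/
lemma IsEmbedding.exists_gradLossN_eq {U : (j : ℕ) → Matrix (Fin (d j)) (Fin (d N)) ℝ}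
    {w : ℕ → Matrix (Fin (d N)) (Fin (d N)) ℝ} {W : Params N d} (h : IsEmbedding U w W)
    {S₀ : Matrix (Fin (d N)) (Fin (d N)) ℝ} (hS₀ : S₀.PosDef)
    (hx : (prefixMul w N * (prefixMul w N)ᵀ).PosDef) :
    ∃ y : Matrix (Fin (d N)) (Fin (d N)) ℝ, y * yᵀ = S₀ ∧
      lossN S₀ W = frobNorm (prefixMul w N - y) ^ 2 ∧
      (∀ x' : Matrix (Fin (d N)) (Fin (d N)) ℝ,
        lossOne S₀ (x' * (U 0)ᵀ) ≤ frobNorm (x' - y) ^ 2) ∧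
      DifferentiableAt ℝ (lossN S₀ : Params N d → ℝ) W ∧
      ∀ (j : ℕ) (hj : j < N),
        gradLossN S₀ W ⟨j, hj⟩ = U (j + 1) * distGrad w N y j * (U j)ᵀ := by
  rw [← h.endToEnd_mul_transpose] at hx
  obtain ⟨Y, C, hY, hV, h0, hup, hlow⟩ := exists_lossOne_eq hS₀ hx
  have hU0 := h.isometry 0 (Nat.zero_le N)
  -- The rows of the end-to-end matrix lie in the image of `U 0`, hence so do those of `Y`, and `Y
  -- U₀` is the square target.
  have hYU : Y * U 0 * (U 0)ᵀ = Y := hV _ (U 0) (by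
    rw [h.endToEnd_eq, Matrix.mul_assoc (prefixMul w N), hU0, Matrix.mul_one])
  have hsub : ∀ x' : Matrix (Fin (d N)) (Fin (d N)) ℝ,
      x' * (U 0)ᵀ - Y = (x' - Y * U 0) * (U 0)ᵀ := fun x' => by
    rw [Matrix.sub_mul, hYU]
  refine ⟨Y * U 0, ?_, ?_, fun x' => ?_, differentiableAt_lossN h0 hup hlow, fun j hj => ?_⟩
  · rw [Matrix.transpose_mul, ← Matrix.mul_assoc, hYU, hY]
  · rw [lossN, h0, h.endToEnd_eq, hsub, frobNorm_mul_transpose_of_isometry _ hU0]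
  · refine (hup _).trans (le_of_eq ?_)
    rw [hsub, frobNorm_mul_transpose_of_isometry _ hU0]
  · have hB : (U 0)ᵀ * (partialProd W j hj.le)ᵀ = (prefixMul w j)ᵀ * (U j)ᵀ := by
      rw [← Matrix.transpose_mul, h.partialProd_mul_eq hj.le, Matrix.transpose_mul]
    rw [gradLossN_apply h0 hup hlow ⟨j, hj⟩, h.suffixProd_eq, h.endToEnd_eq, hsub,
      Matrix.transpose_mul, Matrix.transpose_transpose, distGrad,
      show N - (j + 1) = N - 1 - j by omega]
    simp only [Matrix.mul_smul, Matrix.smul_mul, Matrix.mul_assoc, hB]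

lemma posDef_mul_transpose_of_mul {n p q : ℕ} {A : Matrix (Fin n) (Fin p) ℝ}
    {B : Matrix (Fin p) (Fin q) ℝ} (h : (A * B * (A * B)ᵀ).PosDef) : (A * Aᵀ).PosDef := by
  refine Matrix.PosDef.of_dotProduct_mulVec_pos (posSemidef_mul_transpose A).isHermitian
    fun v hv => ?_
  have h1 := (posSemidef_mul_transpose A).dotProduct_mulVec_nonneg v
  refine lt_of_le_of_ne h1 fun h0 => ?_
  have h2 : Aᵀ *ᵥ v = 0 := by
    rw [← Matrix.mulVec_mulVec, star_trivial, Matrix.dotProduct_mulVec, ← Matrix.mulVec_transpose]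
      at h0
    exact dotProduct_self_eq_zero.1 h0.symm
  have h3 := h.dotProduct_mulVec_pos hv
  rw [Matrix.transpose_mul, ← Matrix.mul_assoc, ← Matrix.mulVec_mulVec, h2] at h3
  simp at h3

/-- Balanced weights with end-to-end matrix of full row rank are embedded from a constant sequence
of a positive definite matrix. -/
lemma BalancedWeights.exists_isEmbedding {W : Params N d} (hN : 1 ≤ N) (hbal : BalancedWeights W)
    (hW : (endToEnd W * (endToEnd W)ᵀ).PosDef) :
    ∃ (U : (j : ℕ) → Matrix (Fin (d j)) (Fin (d N)) ℝ) (b : Matrix (Fin (d N)) (Fin (d N)) ℝ),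
      bᵀ = b ∧ IsEmbedding U (fun _ => b) W := by
  obtain ⟨p, rfl⟩ := Nat.exists_eq_add_of_le' hN
  have hlast : (W ⟨p, p.lt_succ_self⟩ * (W ⟨p, p.lt_succ_self⟩)ᵀ).PosDef :=
    posDef_mul_transpose_of_mul (B := partialProd W p (Nat.le_succ p)) hW
  set b := CFC.sqrt (W ⟨p, p.lt_succ_self⟩ * (W ⟨p, p.lt_succ_self⟩)ᵀ)
  have hb : b.PosDef := hlast.sqrt
  have hbb : b * b = W ⟨p, p.lt_succ_self⟩ * (W ⟨p, p.lt_succ_self⟩)ᵀ :=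
    hlast.posSemidef.sqrt_mul_sqrt
  have hbt : bᵀ = b := transpose_sqrt _
  have hbit : b⁻¹ᵀ = b⁻¹ := by rw [Matrix.transpose_nonsing_inv, hbt]
  obtain ⟨V, hVlast, hVstep⟩ : ∃ V : (j : ℕ) → j ≤ p + 1 →
      Matrix (Fin (d j)) (Fin (d (p + 1))) ℝ, V (p + 1) le_rfl = 1 ∧
      ∀ (j : ℕ) (hj : j < p + 1), V j hj.le = (W ⟨j, hj⟩)ᵀ * V (j + 1) hj * b⁻¹ := by
    -- Closed form of the downward recursion that solves `W_j = V_{j+1} b V_jᵀ` for `V_j`.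
    refine ⟨fun j hj => (suffixProd W hj)ᵀ * b⁻¹ ^ (p + 1 - j), by simp [suffixProd_self],
      fun j hj => ?_⟩
    simp only
    rw [suffixProd_of_lt W hj, show p + 1 - j = p + 1 - (j + 1) + 1 by omega, pow_succ,
      Matrix.transpose_mul]
    simp only [Matrix.mul_assoc]
  have key : ∀ (j : ℕ) (hj : j < p + 1), (V (j + 1) hj)ᵀ * V (j + 1) hj = 1 ∧
      W ⟨j, hj⟩ * (W ⟨j, hj⟩)ᵀ = V (j + 1) hj * (b * b) * (V (j + 1) hj)ᵀ →
      (V j hj.le)ᵀ * V j hj.le = 1 ∧ W ⟨j, hj⟩ = V (j + 1) hj * b * (V j hj.le)ᵀ := by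
    rintro j hj ⟨h1, h2⟩
    rw [hVstep j hj]
    set A := W ⟨j, hj⟩
    set V' := V (j + 1) hj
    -- The column space of `A` is that of `A Aᵀ`, which lies in the image of `V'`.
    have hproj : (1 - V' * V'ᵀ) * A = 0 := by
      have : (1 - V' * V'ᵀ) * A * ((1 - V' * V'ᵀ) * A)ᵀ = 0 := by
        have h3 : (1 - V' * V'ᵀ) * V' = 0 := by
          rw [Matrix.sub_mul, Matrix.one_mul, Matrix.mul_assoc, h1, Matrix.mul_one, sub_self]
        rw [Matrix.transpose_mul, Matrix.mul_assoc, ← Matrix.mul_assoc A, h2]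
        simp only [← Matrix.mul_assoc, h3, Matrix.zero_mul]
      rw [← Matrix.conjTranspose_eq_transpose_of_trivial] at this
      exact Matrix.self_mul_conjTranspose_eq_zero.1 this
    constructor
    · rw [Matrix.transpose_mul, Matrix.transpose_mul, Matrix.transpose_transpose, hbit]
      calc _ = b⁻¹ * (V'ᵀ * (A * Aᵀ) * V') * b⁻¹ := by simp only [Matrix.mul_assoc]
        _ = b⁻¹ * ((V'ᵀ * V') * (b * b) * (V'ᵀ * V')) * b⁻¹ := by
          rw [h2]
          simp only [Matrix.mul_assoc]
        _ = (b⁻¹ * b) * (b * b⁻¹) := by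
          rw [h1]
          simp only [Matrix.one_mul, Matrix.mul_one, Matrix.mul_assoc]
        _ = 1 := by rw [hb.inv_mul_self, hb.mul_inv_self, Matrix.one_mul]
    · rw [Matrix.transpose_mul, Matrix.transpose_mul, Matrix.transpose_transpose, hbit]
      calc A = V' * V'ᵀ * A := by
            rw [Matrix.sub_mul, Matrix.one_mul, sub_eq_zero] at hproj
            exact hproj
        _ = V' * (b * b⁻¹) * (V'ᵀ * A) := by
          rw [hb.mul_inv_self, Matrix.mul_one, Matrix.mul_assoc]
        _ = _ := by simp only [Matrix.mul_assoc]
  have main : ∀ (j : ℕ) (hj : j < p + 1), (V (j + 1) hj)ᵀ * V (j + 1) hj = 1 ∧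
      W ⟨j, hj⟩ * (W ⟨j, hj⟩)ᵀ = V (j + 1) hj * (b * b) * (V (j + 1) hj)ᵀ := by
    intro j hj
    induction Nat.le_of_lt_succ hj using Nat.decreasingInduction with
    | self => rw [hVlast]; simp [hbb]
    | of_succ j hjp ih =>
      have ih := ih (by omega)
      obtain ⟨h1, h2⟩ := key (j + 1) (by omega) ih
      refine ⟨h1, ?_⟩
      -- Balance passes the Gram matrix on to the layer below: `W_j W_jᵀ = W_{j+1}ᵀ W_{j+1}`, and
      -- the factorization of layer `j + 1` is already known.
      rw [hbal j (by omega)]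
      conv_lhs => rw [h2]
      rw [Matrix.transpose_mul, Matrix.transpose_mul, Matrix.transpose_transpose, hbt]
      calc _ = V (j + 1) hj * (b * ((V (j + 1 + 1) (by omega))ᵀ * V (j + 1 + 1) (by omega)) * b) *
            (V (j + 1) hj)ᵀ := by simp only [Matrix.mul_assoc]
        _ = _ := by rw [ih.1, Matrix.mul_one]
  refine ⟨fun j => if hj : j ≤ p + 1 then V j hj else 0, b, hbt, fun j hj => ?_, ?_,
    fun j hj => ?_⟩
  · rw [dif_pos hj]
    rcases Nat.lt_or_ge j (p + 1) with hj' | hj'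
    · exact (key j hj' (main j hj')).1
    · obtain rfl : j = p + 1 := le_antisymm hj hj'
      rw [hVlast]
      simp
  · rw [dif_pos le_rfl, hVlast]
  · rw [dif_pos (show j + 1 ≤ p + 1 from hj), dif_pos hj.le]
    exact (key j hj (main j hj)).2

end SquareReduction

/-! ### Consequences of the modified deficiency margin. -/

section Margin

variable {n q : ℕ} {S₀ : Matrix (Fin n) (Fin n) ℝ}

open scoped InnerProductSpace in
-- Expansion in an eigenbasis of `A* A`; the eigenvalues are sorted decreasingly, so the one with
-- index `n - 1` is the least.
lemma sigmaMin_sq_smul_one_le (A : Matrix (Fin n) (Fin n) ℝ) (hn : 1 ≤ n) :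
    sigmaMin A ^ 2 • (1 : Matrix (Fin n) (Fin n) ℝ) ≤ Aᵀ * A := by
  have hσ : 0 ≤ sigmaMin A := LinearMap.singularValues_nonneg _ _
  have hiff := smul_one_le_mul_transpose_iff (A := Aᵀ) hσ
  rw [Matrix.transpose_transpose] at hiff
  rw [hiff]
  intro v
  set T := Matrix.toEuclideanLin A with hT
  have hfin : Module.finrank ℝ (EuclideanSpace ℝ (Fin n)) = n := by simp
  have hsymm := T.isSymmetric_adjoint_comp_self
  set b := hsymm.eigenvectorBasis hfin
  have hev : ∀ i, sigmaMin A ^ 2 ≤ hsymm.eigenvalues hfin i := fun i => by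
    rw [sigmaMin, LinearMap.sq_singularValues_of_lt _ hfin (show n - 1 < n by omega)]
    exact hsymm.eigenvalues_antitone hfin (Fin.mk_le_mk.2 (by omega) : i ≤ ⟨n - 1, by omega⟩)
  have e1 : ‖T v‖ ^ 2 = ∑ i, hsymm.eigenvalues hfin i * ⟪b i, v⟫_ℝ ^ 2 := by
    have h1 : ‖T v‖ ^ 2 = ⟪v, (T.adjoint ∘ₗ T) v⟫_ℝ := by
      rw [LinearMap.comp_apply, LinearMap.adjoint_inner_right, real_inner_self_eq_norm_sq]
    rw [h1, ← b.sum_inner_mul_inner]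
    refine Finset.sum_congr rfl fun i _ => ?_
    have h2 : ⟪b i, (T.adjoint ∘ₗ T) v⟫_ℝ = hsymm.eigenvalues hfin i * ⟪b i, v⟫_ℝ := by
      rw [← hsymm (b i) v, hsymm.apply_eigenvectorBasis hfin i, inner_smul_left]
      rfl
    rw [h2, real_inner_comm]
    ring
  have e2 : ‖v‖ ^ 2 = ∑ i, ⟪b i, v⟫_ℝ ^ 2 := by
    rw [← b.sum_sq_norm_inner_right v]
    simp
  refine le_of_sq_le_sq ?_ (norm_nonneg _)
  rw [mul_pow, e1, e2, Finset.mul_sum]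
  exact Finset.sum_le_sum fun i _ => mul_le_mul_of_nonneg_right (hev i) (sq_nonneg _)

lemma sqrt_mul_orthogonal_mul_transpose (hS₀ : S₀.PosSemidef)
    (U : Matrix.orthogonalGroup (Fin n) ℝ) :
    CFC.sqrt S₀ * (U : Matrix (Fin n) (Fin n) ℝ) * (CFC.sqrt S₀ * (U : Matrix (Fin n) (Fin n) ℝ))ᵀ =
      S₀ := by
  have hU : (U : Matrix (Fin n) (Fin n) ℝ) * (U : Matrix (Fin n) (Fin n) ℝ)ᵀ = 1 :=
    Matrix.mem_orthogonalGroup_iff _ _ |>.1 U.2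
  rw [Matrix.transpose_mul, transpose_sqrt, Matrix.mul_assoc,
    ← Matrix.mul_assoc (U : Matrix (Fin n) (Fin n) ℝ),
    hU, Matrix.one_mul, hS₀.sqrt_mul_sqrt]

/-- The loss depends on `X` only through `X Xᵀ`, so `X` may be replaced by `(X Xᵀ)^{1/2}`, for which
every orthogonal `U` gives an upper bound. -/
lemma sqrt_lossOne_le_of_margin (hS₀ : S₀.PosSemidef) {X : Matrix (Fin n) (Fin q) ℝ} {c : ℝ}
    (h : HasModifiedDeficiencyMargin S₀ (X * Xᵀ) c) :
    Real.sqrt (lossOne S₀ X) ≤ sigmaMin (CFC.sqrt S₀) - c := by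
  refine le_trans (le_ciInf fun U => ?_) h
  have hU : (U : Matrix (Fin n) (Fin n) ℝ) * (U : Matrix (Fin n) (Fin n) ℝ)ᵀ = 1 :=
    Matrix.mem_orthogonalGroup_iff _ _ |>.1 U.2
  have h1 := lossOne_le_frobNorm_sub_sq hS₀ (CFC.sqrt (X * Xᵀ)) U hU
  rw [lossOne, transpose_sqrt, (posSemidef_mul_transpose X).sqrt_mul_sqrt] at h1
  exact Real.sqrt_le_iff.2 ⟨frobNorm_nonneg _, h1⟩

lemma sigmaMin_sqrt_sq_smul_one_le (hS₀ : S₀.PosSemidef) (hn : 1 ≤ n) :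
    sigmaMin (CFC.sqrt S₀) ^ 2 • (1 : Matrix (Fin n) (Fin n) ℝ) ≤ S₀ := by
  have := sigmaMin_sq_smul_one_le (CFC.sqrt S₀) hn
  rwa [transpose_sqrt, hS₀.sqrt_mul_sqrt] at this

lemma sigmaMin_sqrt_le_frobNorm (hS₀ : S₀.PosSemidef) (hn : 1 ≤ n) :
    sigmaMin (CFC.sqrt S₀) ≤ frobNorm (CFC.sqrt S₀) := by
  refine le_of_sq_le_sq ?_ (frobNorm_nonneg _)
  have h := trace_le_of_le (sigmaMin_sqrt_sq_smul_one_le hS₀ hn)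
  rw [frobNorm_sqrt_sq hS₀]
  rw [Matrix.trace_smul, Matrix.trace_one, Fintype.card_fin, smul_eq_mul] at h
  have : (1 : ℝ) ≤ n := by exact_mod_cast hn
  nlinarith [sq_nonneg (sigmaMin (CFC.sqrt S₀))]

lemma one_le_of_margin {S : Matrix (Fin n) (Fin n) ℝ} {c : ℝ} (hc : 0 < c)
    (h : HasModifiedDeficiencyMargin S₀ S c) : 1 ≤ n := by
  by_contra! hn
  -- For `n = 0` the index `n - 1` truncates to `0`, where the list of singular values has the
  -- default value `0`.
  have h1 : sigmaMin (CFC.sqrt S₀) = 0 :=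
    LinearMap.singularValues_of_finrank_le _ (by simp; omega)
  have h2 : 0 ≤ ⨅ U : Matrix.orthogonalGroup (Fin n) ℝ,
      frobNorm (CFC.sqrt S - CFC.sqrt S₀ * (U : Matrix (Fin n) (Fin n) ℝ)) :=
    le_ciInf fun U => frobNorm_nonneg _
  rw [HasModifiedDeficiencyMargin, h1] at h
  linarith

lemma posDef_of_margin (hS₀ : S₀.PosSemidef) {X : Matrix (Fin n) (Fin q) ℝ} {c : ℝ} (hc : 0 < c)
    (h : HasModifiedDeficiencyMargin S₀ (X * Xᵀ) c) : (X * Xᵀ).PosDef := by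
  have hn := one_le_of_margin hc h
  obtain ⟨U, hU⟩ := exists_lt_of_ciInf_lt (lt_of_le_of_lt h (sub_lt_self _ hc))
  have h1 := smul_one_le_mul_transpose_of_sub (X := CFC.sqrt (X * Xᵀ))
    (Y := CFC.sqrt S₀ * (U : Matrix (Fin n) (Fin n) ℝ))
    (by rw [sqrt_mul_orthogonal_mul_transpose hS₀]; exact sigmaMin_sqrt_sq_smul_one_le hS₀ hn)
    le_rfl hU.le
  rw [transpose_sqrt, (posSemidef_mul_transpose X).sqrt_mul_sqrt] at h1
  exact posDef_of_smul_one_le (pow_pos (sub_pos.2 hU) 2) h1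

end Margin

/-! ### The iteration: invariant, linear rate and step size. -/

section GradientDescent

variable {N : ℕ} {d : ℕ → ℕ}

/-- Linear convergence of gradient descent, given a descent estimate for the square network that
holds as long as the imbalance is controlled by the decrease of the loss. -/
lemma gradientDescent_linear_convergence {S₀ : Matrix (Fin (d N)) (Fin (d N)) ℝ} {η σ l ρ : ℝ}
    (hS₀ : S₀.PosDef) (hσ : σ ^ 2 • (1 : Matrix (Fin (d N)) (Fin (d N)) ℝ) ≤ S₀) (hlσ : l < σ)
    (hl : 0 ≤ l) (hη : 0 ≤ η)
    {W : ℕ → Params N d} (hW : IsGradientDescent S₀ η W)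
    {U : (j : ℕ) → Matrix (Fin (d j)) (Fin (d N)) ℝ} {b : Matrix (Fin (d N)) (Fin (d N)) ℝ}
    (hb : bᵀ = b) (hU : IsEmbedding U (fun _ => b) (W 0))
    (hpd : (endToEnd (W 0) * (endToEnd (W 0))ᵀ).PosDef) (h0 : lossN S₀ (W 0) ≤ l ^ 2)
    (hstep : ∀ (w : ℕ → Matrix (Fin (d N)) (Fin (d N)) ℝ) (y : Matrix (Fin (d N)) (Fin (d N)) ℝ),
      y * yᵀ = S₀ → frobNorm (prefixMul w N - y) ≤ l →
      ∑ j ∈ Finset.range (N - 1), ‖imbalance w j‖ ≤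
        4 * η * (l ^ 2 - frobNorm (prefixMul w N - y) ^ 2) →
      4 * N * ρ * frobNorm (prefixMul w N - y) ^ 2 ≤
          ∑ j ∈ Finset.range N, frobNorm (distGrad w N y j) ^ 2 ∧
        frobNorm (prefixMul (w + fun j => -(η • distGrad w N y j)) N - y) ^ 2 ≤
          frobNorm (prefixMul w N - y) ^ 2 -
            η / 2 * ∑ j ∈ Finset.range N, frobNorm (distGrad w N y j) ^ 2) (k : ℕ) :
    DifferentiableAt ℝ (lossN S₀ : Params N d → ℝ) (W k) ∧
      lossN S₀ (W (k + 1)) ≤ (1 - 2 * η * N * ρ) * lossN S₀ (W k) := by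
  -- The inductive invariant: the embeddings `U` stay fixed, the product stays invertible, and the
  -- imbalance is controlled by the loss already removed.
  have key : ∀ k, (∃ w, IsEmbedding U w (W k) ∧ (prefixMul w N * (prefixMul w N)ᵀ).PosDef ∧
      ∑ j ∈ Finset.range (N - 1), ‖imbalance w j‖ ≤ 4 * η * (l ^ 2 - lossN S₀ (W k)) ∧
      lossN S₀ (W k) ≤ l ^ 2) →
      DifferentiableAt ℝ (lossN S₀ : Params N d → ℝ) (W k) ∧
      lossN S₀ (W (k + 1)) ≤ (1 - 2 * η * N * ρ) * lossN S₀ (W k) ∧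
      ∃ w, IsEmbedding U w (W (k + 1)) ∧ (prefixMul w N * (prefixMul w N)ᵀ).PosDef ∧
        ∑ j ∈ Finset.range (N - 1), ‖imbalance w j‖ ≤ 4 * η * (l ^ 2 - lossN S₀ (W (k + 1))) ∧
        lossN S₀ (W (k + 1)) ≤ l ^ 2 := by
    rintro k ⟨w, hw, hx, hδ, hL⟩
    obtain ⟨y, hy, hloss, hup, hdiff, hgrad⟩ := hw.exists_gradLossN_eq hS₀ hx
    rw [hloss] at hδ hL
    have he : frobNorm (prefixMul w N - y) ≤ l := le_of_sq_le_sq hL hl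
    obtain ⟨hS, hdec⟩ := hstep w y hy he hδ
    have himb := sum_norm_imbalance_step_le (w := w) (N := N) (y := y) η
    set S := ∑ j ∈ Finset.range N, frobNorm (distGrad w N y j) ^ 2
    set w' := w + fun j => -(η • distGrad w N y j) with hw'
    have hS0 : 0 ≤ S := Finset.sum_nonneg fun _ _ => sq_nonneg _
    have hηS : 0 ≤ η * S := mul_nonneg hη hS0
    have hemb : IsEmbedding U w' (W (k + 1)) := by
      refine ⟨hw.isometry, hw.last, fun j hj => ?_⟩
      rw [hW k, Pi.sub_apply, Pi.smul_apply, hgrad j hj, hw.eq j hj, hw']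
      simp [Matrix.mul_add, Matrix.add_mul, sub_eq_add_neg]
    -- The old target `y` still majorizes the loss at the new weights, although the next step will
    -- have its own target.
    have hloss' : lossN S₀ (W (k + 1)) ≤ frobNorm (prefixMul w' N - y) ^ 2 := by
      rw [lossN, hemb.endToEnd_eq]
      exact hup _
    have he' : frobNorm (prefixMul w' N - y) ≤ l := by
      refine le_of_sq_le_sq ?_ hl
      linarith
    have hx' := smul_one_le_mul_transpose_of_sub (X := prefixMul w' N) (Y := y)
      (by rwa [hy]) he' hlσ.le
    refine ⟨hdiff, ?_, w', hemb, posDef_of_smul_one_le (pow_pos (sub_pos.2 hlσ) 2) hx', ?_, ?_⟩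
    · rw [hloss]
      have := mul_le_mul_of_nonneg_left hS hη
      linarith
    · refine himb.trans ?_
      -- The decrease of the loss is at least `η S / 2`, so the new imbalance `2 η² S` is at most
      -- `4η` times that decrease.
      have h1 : η * (η * S) ≤ η * (2 * (frobNorm (prefixMul w N - y) ^ 2 -
          lossN S₀ (W (k + 1)))) := mul_le_mul_of_nonneg_left (by linarith) hη
      linarith
    · linarith
  have inv : ∀ k, ∃ w, IsEmbedding U w (W k) ∧ (prefixMul w N * (prefixMul w N)ᵀ).PosDef ∧
      ∑ j ∈ Finset.range (N - 1), ‖imbalance w j‖ ≤ 4 * η * (l ^ 2 - lossN S₀ (W k)) ∧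
      lossN S₀ (W k) ≤ l ^ 2 := by
    intro k
    induction k with
    | zero =>
      refine ⟨fun _ => b, hU, by rwa [← hU.endToEnd_mul_transpose], ?_, h0⟩
      have : ∀ j, imbalance (fun _ => b) j = 0 := fun j => by simp [imbalance, hb]
      simp only [this, norm_zero, Finset.sum_const_zero]
      exact mul_nonneg (by linarith) (by linarith)
    | succ k ih => exact (key k ih).2.2
  exact ⟨(key k (inv k)).1, (key k (inv k)).2.1⟩

lemma rpow_inv_pow {x : ℝ} (hx : 0 ≤ x) (N k : ℕ) :
    (x ^ ((N : ℝ)⁻¹)) ^ k = x ^ ((k : ℝ) / N) := by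
  rw [← Real.rpow_natCast, ← Real.rpow_mul hx]
  congr 1
  ring

lemma le_of_log_le {a r ε η' : ℝ} {k : ℕ} {u : ℕ → ℝ} (hr : r = 1 - η') (hη' : 0 < η')
    (hη1 : η' ≤ 1) (hu0 : u 0 = a) (ha : 0 ≤ a) (hu : ∀ k, u (k + 1) ≤ r * u k) (hε : 0 < ε)
    (hk : 1 / η' * Real.log (a / ε) ≤ k) : u k ≤ ε := by
  have hr0 : 0 ≤ r := by linarith
  have h1 : ∀ k, u k ≤ r ^ k * a := by
    intro k
    induction k with
    | zero => simp [hu0]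
    | succ k ih =>
      refine (hu k).trans ((mul_le_mul_of_nonneg_left ih hr0).trans (le_of_eq ?_))
      ring
  -- For `a = 0` the logarithm is `log 0 = 0` and `hk` carries no information, but then `u k ≤ 0`.
  rcases ha.eq_or_lt with h0 | h0
  · have := h1 k
    rw [← h0, mul_zero] at this
    linarith
  · have h2 : r ^ k ≤ Real.exp (-η') ^ k :=
      pow_le_pow_left₀ hr0 (by linarith [Real.add_one_le_exp (-η')]) k
    have h3 : Real.exp (-η') ^ k ≤ ε / a := by
      rw [← Real.exp_nat_mul, ← Real.le_log_iff_exp_le (by positivity)]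
      rw [one_div_mul_eq_div, div_le_iff₀ hη', Real.log_div h0.ne' hε.ne'] at hk
      rw [Real.log_div hε.ne' h0.ne']
      linarith
    calc u k ≤ r ^ k * a := h1 k
      _ ≤ ε / a * a := mul_le_mul_of_nonneg_right (h2.trans h3) ha
      _ = ε := div_mul_cancel₀ _ h0.ne'

/-- The step size condition on `boundDelta` in terms of `N`-th roots. -/
lemma stepsizeBound_of_le_boundDelta {n p : ℕ} {S₀ : Matrix (Fin n) (Fin n) ℝ} {c η l M σ : ℝ}
    (hc : 0 < c) (hη : 0 < η) (hl : 0 ≤ l) (hM : 0 ≤ M)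
    (hM2 : M ^ 2 = 2 * (l ^ 2 + frobNorm (CFC.sqrt S₀) ^ 2)) (hmargin : l + c ≤ σ)
    (hσ : σ ≤ frobNorm (CFC.sqrt S₀))
    (hle : η ≤ ((p + 2 : ℕ) : ℝ) * c ^ (2 * (((p + 2 : ℕ) : ℝ) - 1) / ((p + 2 : ℕ) : ℝ)) /
      (2 * boundDelta (p + 2) c M S₀)) :
    StepsizeBound p l σ (frobNorm (CFC.sqrt S₀)) (M ^ ((((p + 2 : ℕ) : ℝ))⁻¹))
      (c ^ ((((p + 2 : ℕ) : ℝ))⁻¹)) η := by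
  set F := frobNorm (CFC.sqrt S₀) with hF
  have hF0 : 0 < F := by linarith
  have hMpos : 0 < M := by
    refine lt_of_le_of_ne hM fun h => ?_
    rw [← h] at hM2
    nlinarith [sq_nonneg l]
  have hκN : (c ^ ((((p + 2 : ℕ) : ℝ))⁻¹)) ^ (p + 2) = c :=
    Real.rpow_inv_natCast_pow hc.le (by omega)
  have hmN : (M ^ ((((p + 2 : ℕ) : ℝ))⁻¹)) ^ (p + 2) = M :=
    Real.rpow_inv_natCast_pow hM (by omega)
  refine ⟨hl, hη.le, by positivity, by positivity, by rwa [hκN], hσ, by rw [hmN, hM2], ?_⟩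
  have e1 : (c ^ ((((p + 2 : ℕ) : ℝ))⁻¹)) ^ (2 * p + 2) =
      c ^ (2 * (((p + 2 : ℕ) : ℝ) - 1) / ((p + 2 : ℕ) : ℝ)) := by
    rw [rpow_inv_pow hc.le]
    congr 2
    push_cast
    ring
  have e2 : (M ^ ((((p + 2 : ℕ) : ℝ))⁻¹)) ^ (3 * p + 2) =
      M ^ ((3 * ((p + 2 : ℕ) : ℝ) - 4) / ((p + 2 : ℕ) : ℝ)) := by
    rw [rpow_inv_pow hM]
    congr 2
    push_cast
    ring
  rw [e1, e2]
  set A := M ^ ((3 * ((p + 2 : ℕ) : ℝ) - 4) / ((p + 2 : ℕ) : ℝ))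
  set C := c ^ (2 * (((p + 2 : ℕ) : ℝ) - 1) / ((p + 2 : ℕ) : ℝ))
  have hA : 0 < A := by positivity
  -- The part of the second summand of `Δ` containing `F` suffices; everything else is nonnegative.
  have hΔ : 8 * ((p : ℝ) + 2) * (p + 1) * A * F ≤ boundDelta (p + 2) c M S₀ := by
    have h1 : 0 ≤ 2 ^ (p + 2 + 1) / c ^ (2 * (p + 2)) * ((p + 2 : ℕ) : ℝ) ^ 2 *
        M ^ ((4 * ((p + 2 : ℕ) : ℝ) - 3) / ((p + 2 : ℕ) : ℝ)) * Real.sqrt (lambdaMax S₀) := by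
      positivity
    have h2 : 0 ≤ 8 * ((p : ℝ) + 2) * (p + 1) * A * M ^ (1 / ((p + 2 : ℕ) : ℝ)) := by positivity
    have h3 : 8 * ((p + 2 : ℕ) : ℝ) * (((p + 2 : ℕ) : ℝ) - 1) * A *
        (M ^ (1 / ((p + 2 : ℕ) : ℝ)) + F) =
        8 * ((p : ℝ) + 2) * (p + 1) * A * M ^ (1 / ((p + 2 : ℕ) : ℝ)) +
          8 * ((p : ℝ) + 2) * (p + 1) * A * F := by
      push_cast
      ring
    rw [boundDelta, ← hF]
    linarith
  have hΔ0 : 0 < boundDelta (p + 2) c M S₀ := lt_of_lt_of_le (by positivity) hΔ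
  rw [le_div_iff₀ (by positivity)] at hle
  have h4 := mul_le_mul_of_nonneg_left hΔ hη.le
  refine le_of_mul_le_mul_left (a := (p : ℝ) + 2) ?_ (by positivity)
  push_cast at hle
  linarith

end GradientDescent

end

theorem mainTheorem4 (N : ℕ) (hN : 1 ≤ N) (d : ℕ → ℕ)
    (S₀ : Matrix (Fin (d N)) (Fin (d N)) ℝ) (hS₀ : S₀.PosSemidef)
    (c η : ℝ) (hc : 0 < c) (hη : 0 < η)
    (W : ℕ → Params N d) (hW : IsGradientDescent S₀ η W)
    (hbal : BalancedWeights (W 0))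
    (hmargin : HasModifiedDeficiencyMargin S₀ (endToEnd (W 0) * (endToEnd (W 0))ᵀ) c)
    -- `η ≤ c² / (8 M L¹(W(0))^{1/2})`, no restriction if `L¹(W(0)) = 0`
    (hη₁ : η * (8 * boundM S₀ (endToEnd (W 0)) * Real.sqrt (lossOne S₀ (endToEnd (W 0)))) ≤ c ^ 2)
    (hη₂ : η ≤ (N : ℝ) * c ^ (2 * ((N : ℝ) - 1) / N) /
      (2 * boundDelta N c (boundM S₀ (endToEnd (W 0))) S₀))
    (hη₃ : η ≤ 1 / (4 * (N : ℝ) * c ^ (2 * ((N : ℝ) - 1) / N))) :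
    (∀ k : ℕ, DifferentiableAt ℝ (lossN S₀ : Params N d → ℝ) (W k)) ∧
    ∀ ε : ℝ, 0 < ε → ∀ k : ℕ,
      1 / (2 * η * (N : ℝ) * c ^ (2 * ((N : ℝ) - 1) / N)) *
          Real.log (lossOne S₀ (endToEnd (W 0)) / ε) ≤ (k : ℝ) →
        lossN S₀ (W k) ≤ ε := by
  have hn := one_le_of_margin hc hmargin
  have hpd := posDef_of_margin hS₀ hc hmargin
  have hl := sqrt_lossOne_le_of_margin hS₀ hmargin
  set l := Real.sqrt (lossOne S₀ (endToEnd (W 0)))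
  set σ := sigmaMin (CFC.sqrt S₀)
  set ρ := c ^ (2 * ((N : ℝ) - 1) / N) with hρ
  have hl0 : 0 ≤ l := Real.sqrt_nonneg _
  have hσ0 : 0 < σ := by linarith
  have hσ := sigmaMin_sqrt_sq_smul_one_le hS₀ hn
  have hS₀' : S₀.PosDef := posDef_of_smul_one_le (pow_pos hσ0 2) hσ
  have hL0 : 0 ≤ lossOne S₀ (endToEnd (W 0)) := by
    obtain ⟨Y, C, -, -, h, -⟩ := exists_lossOne_eq hS₀' hpd
    rw [h]
    exact sq_nonneg _
  have hl2 : l ^ 2 = lossOne S₀ (endToEnd (W 0)) := Real.sq_sqrt hL0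
  have hρ0 : 0 < ρ := by positivity
  have hN0 : (0 : ℝ) < N := by exact_mod_cast hN
  obtain ⟨U, b, hb, hU⟩ := hbal.exists_isEmbedding hN hpd
  have main := gradientDescent_linear_convergence (ρ := ρ) hS₀' hσ (show l < σ by linarith) hl0 hη.le
    hW hb hU hpd hl2.ge ?_
  · refine ⟨fun k => (main k).1, fun ε hε k hk => ?_⟩
    refine le_of_log_le (u := fun k => lossN S₀ (W k)) rfl (by positivity) ?_ rfl hL0
      (fun k => (main k).2) hε hk
    -- The third step size bound makes `2 η N ρ ≤ 1/2`, so the contraction factor is nonnegative.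
    rw [le_div_iff₀ (by positivity)] at hη₃
    linarith
  · intro w y hy he hδ
    obtain ⟨p, rfl⟩ := Nat.exists_eq_add_of_le' hN
    rcases p with _ | p
    -- For `N = 1` the exponent of `c` vanishes, and the third step size bound becomes `η ≤ 1/4`.
    · have hρ1 : ρ = 1 := by simp [hρ]
      rw [hρ1] at hη₃ ⊢
      have h := descent_step_single (w := w) (y := y) hη.le (hη₃.trans (by norm_num))
      simpa using h
    · have hM2 : boundM S₀ (endToEnd (W 0)) ^ 2 =
          2 * (l ^ 2 + frobNorm (CFC.sqrt S₀) ^ 2) := by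
        rw [boundM, Real.sq_sqrt (by positivity), hl2]
      have hb := stepsizeBound_of_le_boundDelta hc hη hl0 (Real.sqrt_nonneg _) hM2
        (show l + c ≤ σ by linarith) (sigmaMin_sqrt_le_frobNorm hS₀ hn) hη₂
      have hyF : frobNorm y = frobNorm (CFC.sqrt S₀) := by
        rw [← Real.sqrt_sq (frobNorm_nonneg y), ← Real.sqrt_sq (frobNorm_nonneg (CFC.sqrt S₀)),
          frobNorm_sqrt_sq hS₀, frobNorm_sq_eq_of_mul_transpose_eq hy]
      have hbd := fun j (hj : j < p + 2) => hb.layer_bounds hyF (by rwa [hy]) he hδ hj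
      have h := descent_step_of_layer_bounds (he.trans hb.l_le) hη.le hb.κ_pos hb.κ_le
        hb.m_pow_le hb.η_le (fun j hj => (hbd j hj).1) (fun j hj => (hbd j hj).2.1)
        (fun j hj => (hbd j hj).2.2)
      have hρκ : (c ^ ((((p + 2 : ℕ) : ℝ))⁻¹)) ^ (2 * p + 2) = ρ := by
        rw [rpow_inv_pow hc.le, hρ]
        congr 2
        push_cast
        ring
      rw [hρκ] at h
      refine ⟨le_trans (le_of_eq ?_) h.1, h.2⟩
      push_cast
      ring
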